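/- An oriented graph is a digraph obtained from a simple undirected graph by giving each edge a direction; it is connected if its underlying undirected graph is. The skew-adjacency matrix of an oriented graph with vertices $v_1,\dots,v_n$ is the $n\times n$ matrix $S=[s_{ij}]$ with $s_{ij}=1$ if $(v_i,v_j)$ is an arc, $s_{ij}=-1$ if $(v_j,v_i)$ is an arc, and $s_{ij}=0$ otherwise. The skew energy is the sum of the singular values of $S$. Switching an oriented graph with respect to a set $U$ of vertices means reversing every arc that has exactly one end in $U$. Call two oriented graphs equivalent if one is obtained from the other, up to isomorphism of oriented graphs, by a switching, possibly followed by the reversal of all arcs; equivalent oriented graphs have isomorphic underlying graphs and equal skew energy. For $n\le m\le 2n-3$ let $O^+_{n,m}$ be the oriented graph with vertices $v_1,\dots,v_n$ and the $m$ arcs $(v_1,v_j)$ for $2\le j\le n$ and $(v_i,v_2)$ for $3\le i\le m-n+3$. For $n\le m<2(n-2)$ let $B^+_{n,m}$ be the oriented graph obtained from $O^+_{n,m+1}$ by deleting the arc $(v_1,v_2)$. **Theorem.** Let $n\le m<2(n-2)$, and let $G^\sigma$ be an oriented graph on $n$ vertices. Then $G^\sigma$ is connected with $m$ arcs and has minimal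 skew energy among all connected oriented graphs with $n$ vertices and $m$ arcs if and only if 1. $G^\sigma$ is equivalent to $O^+_{n,m}$, in the case $m<\frac{3n-5}{2}$; 2. $G^\sigma$ is equivalent to $O^+_{n,m}$ or to $B^+_{n,m}$, in the case $m=\frac{3n-5}{2}$; 3. $G^\sigma$ is equivalent to $B^+_{n,m}$, in the case $m>\frac{3n-5}{2}$. -/

import Mathlib

noncomputable section

/-- An oriented graph: a digraph in which at most one of the ordered pairs `(u, v)`, `(v, u)` is an
arc; in particular there are no loops. `G.Adj u v` says that `(u, v)` is an arc, with tail `u` and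
head `v`. -/
structure OrientedGraph (V : Type*) extends Digraph V where
  asymm : ∀ u v, Adj u v → ¬ Adj v u

namespace OrientedGraph

variable {V W : Type*}

/-- The underlying simple undirected graph. -/
def underlying (G : OrientedGraph V) : SimpleGraph V :=
  G.toDigraph.toSimpleGraphInclusive

/-- An oriented graph is connected if its underlying graph is. -/
def Connected (G : OrientedGraph V) : Prop :=
  G.underlying.Connected

/-- The number of arcs. -/
def numArcs (G : OrientedGraph V) : ℕ :=
  Set.ncard {p : V × V | G.Adj p.1 p.2}

open Classical in
/-- The skew-adjacency matrix. -/
def skewAdjMatrix (G : OrientedGraph V) : Matrix V V ℝ :=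
  Matrix.of fun u v => if G.Adj u v then 1 else if G.Adj v u then -1 else 0

open Classical in
/-- The skew energy: the sum of the singular values, with multiplicity, of the skew-adjacency
matrix. -/
def skewEnergy [Fintype V] (G : OrientedGraph V) : ℝ :=
  ∑ i ∈ Finset.range (Fintype.card V),
    (Matrix.toEuclideanLin G.skewAdjMatrix).singularValues i

/-- Isomorphism of oriented graphs: a bijection of the vertices that preserves arcs, with their
directions, in both directions. -/
def Isomorphic (G : OrientedGraph V) (H : OrientedGraph W) : Prop :=
  ∃ e : V ≃ W, ∀ u v, G.Adj u v ↔ H.Adj (e u) (e v)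

/-- Switching with respect to `U`: the arcs with exactly one end in `U` are reversed, all others
are kept. -/
def switch (G : OrientedGraph V) (U : Set V) : OrientedGraph V where
  Adj u v := ((u ∈ U ↔ v ∈ U) ∧ G.Adj u v) ∨ (¬ (u ∈ U ↔ v ∈ U) ∧ G.Adj v u)
  asymm u v := by
    have h1 := G.asymm u v
    have h2 := G.asymm v u
    tauto

/-- All arcs are reversed. -/
def reverse (G : OrientedGraph V) : OrientedGraph V where
  Adj u v := G.Adj v u
  asymm u v := G.asymm v u

/-- `G` and `H` coincide up to isomorphism, switching, and reversal of all arcs. -/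
def SwitchingIsomorphic (G : OrientedGraph V) (H : OrientedGraph W) : Prop :=
  ∃ U : Set V, (G.switch U).Isomorphic H ∨ (G.switch U).reverse.Isomorphic H

/-- `G` has minimal skew energy among all connected oriented graphs with `n` vertices and
`m` arcs. -/
def IsMinimalSkewEnergy {n : ℕ} (m : ℕ) (G : OrientedGraph (Fin n)) : Prop :=
  G.Connected ∧ G.numArcs = m ∧
    ∀ H : OrientedGraph (Fin n), H.Connected → H.numArcs = m → G.skewEnergy ≤ H.skewEnergy

/-- The oriented graph `O⁺` with `n` vertices and `m` arcs (for `n ≤ m ≤ 2 n - 3`). The vertex `0`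
is `v₁`, the vertex `1` is `v₂`. There are the `n - 1` arcs `(v₁, j)` of a star, and the `m - n + 1`
arcs `(i, v₂)` from the vertices `i = 2, …, m - n + 2`. -/
def oPlus (n m : ℕ) : OrientedGraph (Fin n) where
  Adj i j := ((i : ℕ) = 0 ∧ (j : ℕ) ≠ 0) ∨ (2 ≤ (i : ℕ) ∧ (i : ℕ) + n ≤ m + 2 ∧ (j : ℕ) = 1)
  asymm i j := by omega

/-- The oriented graph `B⁺` with `n` vertices and `m` arcs: the arc `(v₁, v₂)` is deleted from
the oriented graph `O⁺` with `n` vertices and `m + 1` arcs. -/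
def bPlus (n m : ℕ) : OrientedGraph (Fin n) where
  Adj i j := (oPlus n (m + 1)).Adj i j ∧ ¬ ((i : ℕ) = 0 ∧ (j : ℕ) = 1)
  asymm i j h h' := (oPlus n (m + 1)).asymm i j h.1 h'.1

end OrientedGraph

end

set_option linter.unusedSectionVars false
set_option linter.unusedVariables false

/-! ### Singular values of a real skew-symmetric matrix and a lower bound for their sum. -/

open Module
-- The positive singular values of a real skew-symmetric matrix `S` come in equal pairs; take one
-- value σ from each pair. Then Σσ² = m, and b = e₂(σ²) is the sum of the 4 × 4 principal minors of
-- `S`, that is, of the squared Pfaffians over all 4-sets of vertices. Since (Σσ)² = m + 2e₂(σ) and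
-- e₂(σ)² ≥ e₂(σ²), the energy is at least 2√(m + 2√b), with equality if the rank is at most 4
-- (`skewEnergy_bound`). In `oPlus` and `bPlus` two vertices cover all arcs, so their rank is at
-- most 4, and the problem becomes to minimise b.
--
-- A squared Pfaffian is a nonnegative integer with the parity of the number of perfect matchings on
-- its four vertices. So b is at least the number of 4-sets with an odd number of perfect matchings,
-- which depends on the underlying graph only. Put k = m - n + 1. By `IsAdjFun.quadBound` this
-- number is at least k(n-2-k) or at least (k+1)(n-3-k), the values of b for `oPlus` and `bPlus`.
-- Their difference is 2m - (3n-5), whence the three cases.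
--
-- The bound is proved by induction on the vertex set. Connectedness is weakened to the absence of
-- isolated vertices and isolated edges, a property that survives the deletions used unless the
-- vertex lies in a three-vertex component, which is then deleted whole. A dominating vertex allows
-- a direct estimate; otherwise a vertex of degree at most 3 is deleted. Equality forces a double
-- star with parity and squared Pfaffian equal on every quadruple. The vanishing Pfaffians of its
-- 4-cycles then determine the orientation up to switching and reversal.
theorem LinearMap.even_finrank_eigenspace_adjoint_comp_self {E : Type*} [NormedAddCommGroup E]
    [InnerProductSpace ℝ E] [FiniteDimensional ℝ E] (T : E →ₗ[ℝ] E)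
    (hT : LinearMap.adjoint T = -T) {t : ℝ} (ht : 0 < t) :
    Even (finrank ℝ (Module.End.eigenspace (LinearMap.adjoint T ∘ₗ T) t)) := by
  have hmem : ∀ x, x ∈ Module.End.eigenspace (LinearMap.adjoint T ∘ₗ T) t ↔ -T (T x) = t • x := by
    intro x
    rw [Module.End.mem_eigenspace_iff, hT]
    simp
  set K := Module.End.eigenspace (LinearMap.adjoint T ∘ₗ T) t
  have hinv : ∀ x ∈ K, T x ∈ K := by
    intro x hx
    rw [hmem] at hx ⊢
    rw [← map_neg, hx, map_smul]
  have hsq : T.restrict hinv * T.restrict hinv = (-t) • (1 : K →ₗ[ℝ] K) := by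
    ext x
    have := (hmem x).1 x.2
    simp [← this]
  by_contra hodd
  -- On the eigenspace `T` squares to `-t`, so in odd dimension the square of its determinant would
  -- be negative.
  rw [Nat.not_even_iff_odd] at hodd
  have h1 := congrArg LinearMap.det hsq
  rw [map_mul, LinearMap.det_smul, map_one, mul_one] at h1
  have h2 : (-t) ^ finrank ℝ K < 0 := hodd.pow_neg (by linarith)
  nlinarith [mul_self_nonneg (LinearMap.det (T.restrict hinv))]

theorem Multiset.exists_eq_add_self_add_replicate_zero (M : Multiset ℝ) (h0 : ∀ x ∈ M, 0 ≤ x)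
    (heven : ∀ x, 0 < x → Even (M.count x)) :
    ∃ (P : Multiset ℝ) (c : ℕ), M = P + P + Multiset.replicate c 0 ∧ ∀ x ∈ P, 0 < x := by
  classical
  refine ⟨∑ x ∈ M.toFinset.filter (0 < ·), Multiset.replicate (M.count x / 2) x, M.count 0, ?_, ?_⟩
  · ext y
    simp only [Multiset.count_add, Multiset.count_sum', Multiset.count_replicate]
    rw [Finset.sum_ite_eq']
    rcases lt_trichotomy y 0 with hy | rfl | hy
    · have h1 : M.count y = 0 := Multiset.count_eq_zero.2 fun h => absurd (h0 y h) (by linarith)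
      simp [hy.not_gt, h1, hy.ne']
    · simp
    · obtain ⟨r, hr⟩ := heven y hy
      by_cases hm : y ∈ M
      · simp [hy, hm, hr, hy.ne]; omega
      · simp [hm, hy.ne]
  · intro x hx
    rw [Multiset.mem_sum] at hx
    obtain ⟨y, hy, hxy⟩ := hx
    rw [Multiset.eq_of_mem_replicate hxy]
    exact (Finset.mem_filter.1 hy).2

theorem LinearMap.IsSymmetric.trace_comp_self_eq_sum_eigenvalues_sq {E : Type*}
    [NormedAddCommGroup E] [InnerProductSpace ℝ E] [FiniteDimensional ℝ E] {T : E →ₗ[ℝ] E} {n : ℕ}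
    (hT : T.IsSymmetric) (hn : finrank ℝ E = n) :
    LinearMap.trace ℝ E (T ∘ₗ T) = ∑ i, hT.eigenvalues hn i ^ 2 := by
  rw [LinearMap.trace_eq_sum_inner _ (hT.eigenvectorBasis hn)]
  refine Finset.sum_congr rfl fun i _ => ?_
  simp [hT.apply_eigenvectorBasis hn i, real_inner_smul_right, sq]

theorem Matrix.trace_toEuclideanLin {V : Type*} [Fintype V] [DecidableEq V] (M : Matrix V V ℝ) :
    LinearMap.trace ℝ _ (Matrix.toEuclideanLin M) = M.trace := by
  rw [Matrix.toEuclideanLin, Matrix.toLpLin_eq_toLin, Matrix.trace_toLin_eq]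

/-- `P` keeps half of the copies of each positive singular value, which is possible because the
eigenspaces of `SᵀS` for positive eigenvalues have even dimension. The rank counts the nonzero
singular values, hence twice the size of `P`. -/
theorem Matrix.exists_multiset_half_singularValues {V : Type*} [Fintype V] [DecidableEq V]
    (S : Matrix V V ℝ) (hS : S.transpose = -S) :
    ∃ P : Multiset ℝ, (∀ x ∈ P, 0 < x) ∧
      ∑ i ∈ Finset.range (Fintype.card V), (Matrix.toEuclideanLin S).singularValues i
        = 2 * P.sum ∧
      2 * (P.map (· ^ 2)).sum = (S.transpose * S).trace ∧
      2 * (P.map (· ^ 4)).sum = (S.transpose * S * (S.transpose * S)).trace ∧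
      2 * P.card = S.rank := by
  set T := Matrix.toEuclideanLin S with hTdef
  have hadj : LinearMap.adjoint T = Matrix.toEuclideanLin S.transpose := by
    rw [hTdef, ← Matrix.toEuclideanLin_conjTranspose_eq_adjoint, Matrix.conjTranspose_eq_transpose_of_trivial]
  have hadj' : LinearMap.adjoint T = -T := by rw [hadj, hS, map_neg]
  have hN : LinearMap.adjoint T ∘ₗ T = Matrix.toEuclideanLin (S.transpose * S) := by
    rw [hadj, hTdef, ← Matrix.toLpLin_mul_same]
  have hn : finrank ℝ (EuclideanSpace ℝ V) = Fintype.card V := finrank_euclideanSpace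
  have hsymm := T.isSymmetric_adjoint_comp_self
  have hnn := fun i => T.isPositive_adjoint_comp_self.nonneg_eigenvalues hn i
  set ev := hsymm.eigenvalues hn with hev
  set M : Multiset ℝ := (Finset.univ : Finset (Fin (Fintype.card V))).val.map
    fun i => Real.sqrt (ev i) with hM
  have hsumf : ∀ f : ℝ → ℝ, (M.map f).sum = ∑ i, f (Real.sqrt (ev i)) := by
    intro f
    rw [hM, Multiset.map_map]
    rfl
  have heven : ∀ x, 0 < x → Even (M.count x) := by
    intro x hx
    have h1 := T.even_finrank_eigenspace_adjoint_comp_self hadj' (pow_pos hx 2)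
    have h2 := hsymm.card_filter_eigenvalues_eq hn (x ^ 2)
    rw [← h2] at h1
    rw [hM, Multiset.count_map]
    convert h1 using 1
    rw [Finset.card_def, Finset.filter_val]
    congr 1
    refine Multiset.filter_congr fun i _ => ?_
    rw [eq_comm, Real.sqrt_eq_iff_eq_sq (hnn i) hx.le]
    rfl
  obtain ⟨P, c, hP, hpos⟩ := M.exists_eq_add_self_add_replicate_zero
    (by simp only [hM, Multiset.mem_map]; rintro _ ⟨i, -, rfl⟩; positivity) heven
  refine ⟨P, hpos, ?_, ?_, ?_, ?_⟩
  · have h1 := hsumf id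
    rw [hP, Multiset.map_id] at h1
    simp only [Multiset.sum_add, Multiset.sum_replicate, id, smul_zero, add_zero] at h1
    rw [two_mul, h1, ← Fin.sum_univ_eq_sum_range]
    exact Finset.sum_congr rfl fun i _ => T.singularValues_fin hn i
  · have h1 := hsumf (· ^ 2)
    rw [hP] at h1
    simp only [Multiset.map_add, Multiset.map_replicate, Multiset.sum_add,
      Multiset.sum_replicate] at h1
    rw [two_mul, ← Matrix.trace_toEuclideanLin, ← hN, hsymm.trace_eq_sum_eigenvalues hn]
    simp only [Real.sq_sqrt (hnn _)] at h1
    simpa using h1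
  · have h1 := hsumf (· ^ 4)
    rw [hP] at h1
    simp only [Multiset.map_add, Multiset.map_replicate, Multiset.sum_add,
      Multiset.sum_replicate] at h1
    rw [two_mul, ← Matrix.trace_toEuclideanLin, Matrix.toLpLin_mul_same, ← hN,
      hsymm.trace_comp_self_eq_sum_eigenvalues_sq hn]
    have h4 : ∀ i, Real.sqrt (ev i) ^ 4 = ev i ^ 2 := fun i => by
      rw [show (4 : ℕ) = 2 * 2 from rfl, pow_mul, Real.sq_sqrt (hnn i)]
    simp only [h4] at h1
    simpa using h1
  · have h1 := hsymm.card_filter_eigenvalues_eq hn 0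
    have h2 : S.rank = finrank ℝ (LinearMap.range T) := by
      rw [hTdef, Matrix.toEuclideanLin, Matrix.toLpLin_eq_toLin]
      exact Matrix.rank_eq_finrank_range_toLin _ _ _
    have h3 : M.count 0 = c := by
      rw [hP]
      have : P.count 0 = 0 := Multiset.count_eq_zero.2 fun h => (hpos 0 h).false
      simp [this]
    have h4 : M.count 0 = finrank ℝ (LinearMap.ker T) := by
      rw [← T.ker_adjoint_comp_self, ← Module.End.eigenspace_zero, ← h1, hM, Multiset.count_map,
        Finset.card_def, Finset.filter_val]
      congr 1
      refine Multiset.filter_congr fun i _ => ?_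
      rw [eq_comm, Real.sqrt_eq_zero (hnn i)]
      rfl
    have h5 := T.finrank_range_add_finrank_ker
    have h6 : M.card = Fintype.card V := by simp [hM]
    rw [hP] at h6
    simp only [Multiset.card_add, Multiset.card_replicate] at h6
    rw [h2]
    omega

/-- The last inequality is e₂(x²) ≤ e₂(x)², written in power sums through (Σx)² - Σx² = 2e₂(x). The
other conjuncts are what the induction needs to carry along. -/
theorem Multiset.sum_pow_ineq (P : Multiset ℝ) (hP : ∀ x ∈ P, 0 < x) :
    0 ≤ P.sum ∧ (P.map (· ^ 2)).sum ≤ P.sum ^ 2 ∧ 0 ≤ (P.map (· ^ 2)).sum ∧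
      (P.map (· ^ 4)).sum ≤ (P.map (· ^ 2)).sum ^ 2 ∧
      2 * ((P.map (· ^ 2)).sum ^ 2 - (P.map (· ^ 4)).sum)
        ≤ (P.sum ^ 2 - (P.map (· ^ 2)).sum) ^ 2 := by
  induction P using Multiset.induction_on with
  | empty => simp
  | cons a P ih =>
    obtain ⟨h1, h2, h3, h4, h5⟩ := ih fun x hx => hP x (Multiset.mem_cons_of_mem hx)
    have ha := hP a (Multiset.mem_cons_self a P)
    simp only [Multiset.sum_cons, Multiset.map_cons]
    set s := P.sum
    set p := (P.map (· ^ 2)).sum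
    set q := (P.map (· ^ 4)).sum
    have has : 0 ≤ a * s := by positivity
    refine ⟨by positivity, by nlinarith, by positivity, by nlinarith [sq_nonneg a], ?_⟩
    have h6 : 0 ≤ a * s * (s ^ 2 - p) := mul_nonneg has (by linarith)
    have h7 : 0 ≤ a ^ 2 * (s ^ 2 - p) := mul_nonneg (by positivity) (by linarith)
    nlinarith

/-- For at most two elements e₂ has at most one term, so squaring it produces no cross terms. -/
theorem Multiset.sum_pow_eq_of_card_le_two (P : Multiset ℝ) (hP : P.card ≤ 2) :
    2 * ((P.map (· ^ 2)).sum ^ 2 - (P.map (· ^ 4)).sum)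
      = (P.sum ^ 2 - (P.map (· ^ 2)).sum) ^ 2 := by
  interval_cases h : P.card
  · rw [Multiset.card_eq_zero] at h
    simp [h]
  · obtain ⟨a, rfl⟩ := Multiset.card_eq_one.1 h
    simp; ring
  · obtain ⟨a, b, rfl⟩ := Multiset.card_eq_two.1 h
    simp; ring

namespace OrientedGraph

theorem transpose_skewAdjMatrix {V : Type*} (G : OrientedGraph V) :
    G.skewAdjMatrix.transpose = -G.skewAdjMatrix := by
  ext u v
  have h1 := G.asymm u v
  simp only [skewAdjMatrix, Matrix.transpose_apply, Matrix.of_apply, Matrix.neg_apply]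
  split_ifs <;> simp_all

/-- The two traces say Σσ² = m and e₂(σ²) = b for the halved singular values; rank at most 4 leaves
at most two of them. -/
theorem two_mul_sqrt_le_skewEnergy {V : Type*} [Fintype V] [DecidableEq V] (G : OrientedGraph V)
    {m b : ℝ} (hm : (G.skewAdjMatrix.transpose * G.skewAdjMatrix).trace = 2 * m)
    (hb : (G.skewAdjMatrix.transpose * G.skewAdjMatrix *
      (G.skewAdjMatrix.transpose * G.skewAdjMatrix)).trace = 2 * (m ^ 2 - 2 * b)) :
    2 * √(m + 2 * √b) ≤ G.skewEnergy ∧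
      (G.skewAdjMatrix.rank ≤ 4 → G.skewEnergy = 2 * √(m + 2 * √b)) := by
  obtain ⟨P, hP, hE, h2, h4, hr⟩ :=
    G.skewAdjMatrix.exists_multiset_half_singularValues G.transpose_skewAdjMatrix
  have hE' : G.skewEnergy = 2 * P.sum := by
    rw [← hE, skewEnergy]
    congr!
  obtain ⟨i1, i2, i3, i4, i5⟩ := P.sum_pow_ineq hP
  have hp2 : (P.map (· ^ 2)).sum = m := by linarith
  have hp4 : (P.map (· ^ 4)).sum = m ^ 2 - 2 * b := by linarith
  rw [hp2, hp4] at i5 i4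
  rw [hp2] at i2 i3
  have hb0 : 0 ≤ b := by linarith
  constructor
  · rw [hE']
    have : 2 * √b ≤ P.sum ^ 2 - m := by
      refine le_of_sq_le_sq ?_ (by linarith)
      rw [mul_pow, Real.sq_sqrt hb0]
      linarith
    have := Real.sqrt_le_iff.2 ⟨i1, (by linarith : m + 2 * √b ≤ P.sum ^ 2)⟩
    linarith
  · intro hr4
    have h5 := P.sum_pow_eq_of_card_le_two (by omega)
    rw [hp2, hp4] at h5
    have h6 : P.sum ^ 2 - m = 2 * √b := by
      rw [← sq_eq_sq₀ (by linarith) (by positivity), mul_pow, Real.sq_sqrt hb0]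
      linarith
    rw [hE', ← h6, add_sub_cancel, Real.sqrt_sq i1]

end OrientedGraph

/-! ### Sums of symmetric functions over ordered triples and quadruples. -/

open Finset

/-- A function of four variables that is symmetric and vanishes when two arguments coincide. -/
structure IsAlternatingSymm {V : Type*} (f : V → V → V → V → ℤ) : Prop where
  swap₁ : ∀ a b c d, f b a c d = f a b c d
  swap₂ : ∀ a b c d, f a c b d = f a b c d
  swap₃ : ∀ a b c d, f a b d c = f a b c d
  self : ∀ a c d, f a a c d = 0

/-- The sum of a function over all ordered triples from a finite set. -/
def tripleSum {V : Type*} (S : Finset V) (g : V → V → V → ℤ) : ℤ :=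
  ∑ b ∈ S, ∑ c ∈ S, ∑ d ∈ S, g b c d

/-- The sum of a function over all ordered quadruples from a finite set. -/
def quadSum {V : Type*} (S : Finset V) (f : V → V → V → V → ℤ) : ℤ :=
  ∑ a ∈ S, tripleSum S (f a)

section

variable {V : Type*} [DecidableEq V]

/-- Triples are sorted by how many entries lie in `R`. By symmetry the three positions of the
exceptional entry contribute equally, hence the factors 3. -/
theorem tripleSum_union {N R : Finset V} (hNR : Disjoint N R) (g : V → V → V → ℤ)
    (h₁ : ∀ b c d, g c b d = g b c d) (h₂ : ∀ b c d, g b d c = g b c d) :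
    tripleSum (N ∪ R) g = tripleSum N g + 3 * ∑ b ∈ N, ∑ c ∈ N, ∑ d ∈ R, g b c d +
      3 * ∑ b ∈ N, ∑ c ∈ R, ∑ d ∈ R, g b c d + tripleSum R g := by
  have e1 : ∑ b ∈ N, ∑ c ∈ R, ∑ d ∈ N, g b c d = ∑ b ∈ N, ∑ c ∈ N, ∑ d ∈ R, g b c d := by
    refine sum_congr rfl fun b _ => ?_
    rw [sum_comm]
    exact sum_congr rfl fun c _ => sum_congr rfl fun d _ => h₂ _ _ _
  have e2 : ∑ b ∈ R, ∑ c ∈ N, ∑ d ∈ N, g b c d = ∑ b ∈ N, ∑ c ∈ N, ∑ d ∈ R, g b c d := by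
    rw [← e1, sum_comm]
    exact sum_congr rfl fun c _ => sum_congr rfl fun d _ => sum_congr rfl fun e _ => h₁ _ _ _
  have e3 : ∑ b ∈ R, ∑ c ∈ N, ∑ d ∈ R, g b c d = ∑ b ∈ N, ∑ c ∈ R, ∑ d ∈ R, g b c d := by
    rw [sum_comm]
    exact sum_congr rfl fun c _ => sum_congr rfl fun d _ => sum_congr rfl fun e _ => h₁ _ _ _
  have e4 : ∑ b ∈ R, ∑ c ∈ R, ∑ d ∈ N, g b c d = ∑ b ∈ N, ∑ c ∈ R, ∑ d ∈ R, g b c d := by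
    rw [← e3]
    refine sum_congr rfl fun b _ => ?_
    rw [sum_comm]
    exact sum_congr rfl fun c _ => sum_congr rfl fun d _ => h₂ _ _ _
  simp only [tripleSum, sum_union hNR, sum_add_distrib]
  rw [e1, e2, e3, e4]
  ring

/-- Quadruples in which `v` is repeated contribute nothing, and a single `v` can stand in four
positions. -/
theorem IsAlternatingSymm.quadSum_erase {f : V → V → V → V → ℤ} (hf : IsAlternatingSymm f)
    {S : Finset V} {v : V} (hv : v ∈ S) :
    quadSum S f = quadSum (S.erase v) f + 4 * tripleSum (S.erase v) (f v) := by
  have hdisj : Disjoint {v} (S.erase v) := by simp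
  have hS : S = {v} ∪ S.erase v := by
    rw [← insert_eq, insert_erase hv]
  have key : ∀ a, tripleSum S (f a) =
      3 * ∑ c ∈ S.erase v, ∑ d ∈ S.erase v, f a v c d + tripleSum (S.erase v) (f a) := by
    intro a
    have h0 : ∀ d, f a v v d = 0 := fun d => by
      rw [← hf.swap₁, ← hf.swap₂ v a v d, hf.self]
    conv_lhs => rw [hS]
    rw [tripleSum_union hdisj _ (fun b c d => hf.swap₂ a b c d) (fun b c d => hf.swap₃ a b c d)]
    simp [tripleSum, h0]
  rw [quadSum, sum_congr rfl fun a _ => key a, sum_add_distrib, ← mul_sum]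
  rw [← add_sum_erase _ (fun a => ∑ c ∈ S.erase v, ∑ d ∈ S.erase v, f a v c d) hv,
    ← add_sum_erase _ (fun a => tripleSum (S.erase v) (f a)) hv]
  have h1 : ∑ a ∈ S.erase v, ∑ c ∈ S.erase v, ∑ d ∈ S.erase v, f a v c d
      = tripleSum (S.erase v) (f v) :=
    sum_congr rfl fun c _ => sum_congr rfl fun d _ => sum_congr rfl fun e _ => hf.swap₁ _ _ _ _
  simp only [hf.self, sum_const_zero, h1, quadSum]
  ring

theorem quadSum_mono {f : V → V → V → V → ℤ} (hf : ∀ a b c d, 0 ≤ f a b c d) {S T : Finset V}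
    (h : S ⊆ T) : quadSum S f ≤ quadSum T f := by
  have key : ∀ g : V → ℤ, (∀ x, 0 ≤ g x) → ∑ x ∈ S, g x ≤ ∑ x ∈ T, g x :=
    fun g hg => sum_le_sum_of_subset_of_nonneg h fun x _ _ => hg x
  have n1 : ∀ a b c, 0 ≤ ∑ d ∈ T, f a b c d := fun a b c => sum_nonneg fun d _ => hf a b c d
  have n2 : ∀ a b, 0 ≤ ∑ c ∈ T, ∑ d ∈ T, f a b c d := fun a b => sum_nonneg fun d _ => n1 _ _ _
  have n3 : ∀ a, 0 ≤ ∑ b ∈ T, ∑ c ∈ T, ∑ d ∈ T, f a b c d := fun a => sum_nonneg fun d _ => n2 _ _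
  refine (sum_le_sum fun a _ => ?_).trans (key _ n3)
  refine (sum_le_sum fun b _ => ?_).trans (key _ (n2 a))
  refine (sum_le_sum fun c _ => ?_).trans (key _ (n1 a b))
  exact key _ (hf a b c)

theorem quadSum_nonneg {f : V → V → V → V → ℤ} (hf : ∀ a b c d, 0 ≤ f a b c d) (S : Finset V) :
    0 ≤ quadSum S f :=
  sum_nonneg fun _ _ => sum_nonneg fun _ _ => sum_nonneg fun _ _ => sum_nonneg fun _ _ => hf _ _ _ _

theorem tripleSum_nonneg {g : V → V → V → ℤ} (hg : ∀ b c d, 0 ≤ g b c d) (S : Finset V) :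
    0 ≤ tripleSum S g :=
  sum_nonneg fun _ _ => sum_nonneg fun _ _ => sum_nonneg fun _ _ => hg _ _ _

end

/-! ### Matching parity in graphs and the effect of deleting a vertex. -/

/-- Adjacency functions of simple graphs, with values `0` and `1`. -/
structure IsAdjFun {V : Type*} (A : V → V → ℤ) : Prop where
  zero_or_one : ∀ u v, A u v = 0 ∨ A u v = 1
  symm : ∀ u v, A v u = A u v
  self : ∀ u, A u u = 0

/-- The parity of the number of perfect matchings on four vertices. -/
def matchParity {V : Type*} (A : V → V → ℤ) (a b c d : V) : ℤ :=
  (A a b * A c d + A a c * A b d + A a d * A b c) % 2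

/-- The degree of `v` into `S`. -/
def degIn {V : Type*} (A : V → V → ℤ) (S : Finset V) (v : V) : ℤ := ∑ x ∈ S, A v x

/-- The sum of the degrees inside `S`. -/
def degSum {V : Type*} (A : V → V → ℤ) (S : Finset V) : ℤ := ∑ v ∈ S, degIn A S v

namespace IsAdjFun

variable {V : Type*} {A : V → V → ℤ} (hA : IsAdjFun A)
include hA

theorem nonneg (u v : V) : 0 ≤ A u v := by
  rcases hA.zero_or_one u v with h | h <;> simp [h]

theorem le_one (u v : V) : A u v ≤ 1 := by
  rcases hA.zero_or_one u v with h | h <;> simp [h]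

theorem ne_of_eq_one {u v : V} (h : A u v = 1) : u ≠ v := by
  rintro rfl
  simp [hA.self] at h

theorem matchParity_nonneg (a b c d : V) : 0 ≤ matchParity A a b c d :=
  Int.emod_nonneg _ (by norm_num)

theorem isAlternatingSymm : IsAlternatingSymm (matchParity A) where
  swap₁ a b c d := by
    simp only [matchParity]
    rw [hA.symm a b]
    congr 1
    ring
  swap₂ a b c d := by
    simp only [matchParity]
    rw [hA.symm b c]
    congr 1
    ring
  swap₃ a b c d := by
    simp only [matchParity]
    rw [hA.symm c d]
    congr 1
    ring
  self a c d := by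
    simp only [matchParity, hA.self]
    rw [show 0 * A c d + A a c * A a d + A a d * A a c = A a c * A a d * 2 by ring]
    simp

theorem degIn_nonneg (S : Finset V) (v : V) : 0 ≤ degIn A S v :=
  sum_nonneg fun _ _ => hA.nonneg _ _

theorem degSum_nonneg (S : Finset V) : 0 ≤ degSum A S :=
  sum_nonneg fun _ _ => hA.degIn_nonneg _ _

variable [DecidableEq V]

theorem degIn_eq_card (S : Finset V) (v : V) : degIn A S v = #(S.filter (A v · = 1)) := by
  rw [card_filter, degIn]
  push_cast
  refine sum_congr rfl fun x _ => ?_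
  rcases hA.zero_or_one v x with h | h <;> simp [h]

theorem degIn_union {N R : Finset V} (h : Disjoint N R) (v : V) :
    degIn A (N ∪ R) v = degIn A N v + degIn A R v := sum_union h

theorem degIn_erase {S : Finset V} {v : V} (hv : v ∈ S) (u : V) :
    degIn A S u = degIn A (S.erase v) u + A u v := by
  rw [degIn, degIn, sum_erase_add _ _ hv]

theorem degSum_union {N R : Finset V} (h : Disjoint N R) :
    degSum A (N ∪ R) = degSum A N + 2 * ∑ z ∈ R, degIn A N z + degSum A R := by
  have h1 : ∑ x ∈ N, degIn A R x = ∑ z ∈ R, degIn A N z := by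
    simp only [degIn]
    rw [sum_comm]
    exact sum_congr rfl fun x _ => sum_congr rfl fun y _ => hA.symm _ _
  simp only [degSum, sum_union h, hA.degIn_union h, sum_add_distrib, h1]
  ring

theorem degSum_erase {S : Finset V} {v : V} (hv : v ∈ S) :
    degSum A S = degSum A (S.erase v) + 2 * degIn A S v := by
  have h1 : degSum A {v} = 0 := by simp [degSum, degIn, hA.self]
  have hd : Disjoint {v} (S.erase v) := by simp
  have h2 : ∑ z ∈ S.erase v, degIn A {v} z = degIn A (S.erase v) v := by
    simp only [degIn, sum_singleton]
    exact sum_congr rfl fun x _ => hA.symm _ _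
  conv_lhs => rw [← insert_erase hv, insert_eq, hA.degSum_union hd, h1, h2]
  rw [hA.degIn_erase hv, hA.self]
  ring

omit [DecidableEq V] in
theorem matchParity_of_left {v x y z : V} (hx : A v x = 1) (hy : A v y = 0) (hz : A v z = 0) :
    matchParity A v x y z = A y z := by
  rw [matchParity, hx, hy, hz]
  rcases hA.zero_or_one y z with h | h <;> simp [h]

omit [DecidableEq V] in
-- As `v z` is not an edge, the possible matchings are `v x | y z` and `v y | x z`; their parity is
-- the exclusive or of `A z x` and `A z y`.
theorem matchParity_of_pair {v x y z : V} (hx : A v x = 1) (hy : A v y = 1) (hz : A v z = 0) :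
    matchParity A v x y z = A z x + A z y - 2 * (A z x * A z y) := by
  rw [matchParity, hx, hy, hz, hA.symm z x, hA.symm z y]
  rcases hA.zero_or_one z x with h | h <;> rcases hA.zero_or_one z y with h' | h' <;> simp [h, h']

/-- Deleting `v` with neighbours `N` and non-neighbours `R`. -/
theorem quadSum_erase_le {S N R : Finset V} {v : V} (hv : v ∈ S)
    (hN : N = (S.erase v).filter (A v · = 1)) (hR : R = (S.erase v).filter (A v · = 0)) :
    quadSum (S.erase v) (matchParity A) + 12 * (degIn A S v * degSum A R +
      2 * ∑ z ∈ R, degIn A N z * (degIn A S v - degIn A N z)) ≤ quadSum S (matchParity A) := by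
  have hdisj : Disjoint N R := by
    rw [disjoint_left, hN, hR]
    simp only [mem_filter]
    rintro x ⟨-, h⟩ ⟨-, h'⟩
    omega
  have hNR : S.erase v = N ∪ R := by
    ext x
    have := hA.zero_or_one v x
    simp only [hN, hR, mem_union, mem_filter]
    tauto
  have hd : degIn A S v = #N := by
    rw [hA.degIn_erase hv, hA.self, hA.degIn_eq_card, hN, add_zero]
  have hNm : ∀ x ∈ N, A v x = 1 := fun x hx => by rw [hN] at hx; exact (mem_filter.1 hx).2
  have hRm : ∀ x ∈ R, A v x = 0 := fun x hx => by rw [hR] at hx; exact (mem_filter.1 hx).2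
  have hs := hA.isAlternatingSymm
  rw [hs.quadSum_erase hv, hNR, tripleSum_union hdisj _ (fun b c d => hs.swap₂ v b c d)
    (fun b c d => hs.swap₃ v b c d)]
  have e1 : ∑ b ∈ N, ∑ c ∈ R, ∑ d ∈ R, matchParity A v b c d = degIn A S v * degSum A R := by
    rw [sum_congr rfl fun b hb => sum_congr rfl fun c hc => sum_congr rfl fun d hd =>
      hA.matchParity_of_left (hNm b hb) (hRm c hc) (hRm d hd)]
    rw [hd, sum_const, nsmul_eq_mul]
    rfl
  have e2 : ∑ b ∈ N, ∑ c ∈ N, ∑ d ∈ R, matchParity A v b c d =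
      2 * ∑ z ∈ R, degIn A N z * (degIn A S v - degIn A N z) := by
    rw [sum_congr rfl fun b hb => sum_congr rfl fun c hc => sum_congr rfl fun d hd =>
      hA.matchParity_of_pair (hNm b hb) (hNm c hc) (hRm d hd)]
    rw [sum_congr rfl fun b _ => sum_comm, sum_comm, mul_sum]
    refine sum_congr rfl fun z _ => ?_
    simp only [sum_add_distrib, sum_sub_distrib, ← mul_sum, ← sum_mul, sum_const, nsmul_eq_mul]
    rw [hd]
    simp only [degIn]
    ring
  rw [e1, e2]
  -- Triples inside `N` and triples inside `R` are discarded. The factor 12 is four positions of `v`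
  -- times three positions of the exceptional entry.
  have n1 := tripleSum_nonneg (hA.matchParity_nonneg v) N
  have n2 := tripleSum_nonneg (hA.matchParity_nonneg v) R
  linarith

end IsAdjFun

/-! ### Graphs with a dominating vertex. -/

/-- Inside `S`, the vertex `p` is adjacent to all others except possibly `q`, and every edge
contains `p` or `q`. -/
def IsDoubleStar {V : Type*} (A : V → V → ℤ) (S : Finset V) : Prop :=
  ∃ p ∈ S, ∃ q ∈ S, p ≠ q ∧ (∀ x ∈ S, x ≠ p → x ≠ q → A p x = 1) ∧
    ∀ x ∈ S, ∀ y ∈ S, x ≠ p → y ≠ p → A x y = 1 → x = q ∨ y = q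

namespace IsAdjFun

variable {V : Type*} {A : V → V → ℤ} (hA : IsAdjFun A) [DecidableEq V]
include hA

/-- The edges meeting `a` or `b` number deg a + deg b - 1, since `a b` itself is counted at both
ends. -/
theorem two_mul_degIn_add_degIn {H : Finset V} {a b : V} (ha : a ∈ H) (hb : b ∈ H)
    (hab : A a b = 1) : 2 * (degIn A H a + degIn A H b) + degSum A ((H.erase a).erase b)
      = degSum A H + 2 := by
  have hne := hA.ne_of_eq_one hab
  have h1 := hA.degSum_erase ha
  have h2 := hA.degSum_erase (mem_erase.2 ⟨hne.symm, hb⟩)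
  have h3 := hA.degIn_erase ha b
  rw [hA.symm a b, hab] at h3
  linarith

theorem sum_degIn_sq (H : Finset V) :
    ∑ a ∈ H, ∑ b ∈ H, A a b * (degIn A H a + degIn A H b) = 2 * ∑ a ∈ H, degIn A H a ^ 2 := by
  have h1 : ∑ a ∈ H, ∑ b ∈ H, A a b * degIn A H a = ∑ a ∈ H, degIn A H a ^ 2 :=
    sum_congr rfl fun a _ => by rw [← sum_mul, sq]; rfl
  have h2 : ∑ a ∈ H, ∑ b ∈ H, A a b * degIn A H b = ∑ a ∈ H, degIn A H a ^ 2 := by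
    rw [sum_comm, ← h1]
    exact sum_congr rfl fun a _ => sum_congr rfl fun b _ => by rw [hA.symm]
  simp only [mul_add, sum_add_distrib, h1, h2]
  ring

/-- With k edges in all, deg a + deg b ≤ k + 1 for each edge `a b`; summing over the edges gives Σ
deg². Equality means that no edge is disjoint from any other. -/
theorem sum_degIn_sq_le {H : Finset V} {k : ℤ} (hk : degSum A H = 2 * k) :
    ∑ a ∈ H, degIn A H a ^ 2 ≤ k * (k + 1) ∧
      (k * (k + 1) ≤ ∑ a ∈ H, degIn A H a ^ 2 → ∀ a ∈ H, ∀ b ∈ H, A a b = 1 →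
        degSum A ((H.erase a).erase b) = 0) := by
  have hle : ∀ a ∈ H, ∀ b ∈ H, A a b * (degIn A H a + degIn A H b) ≤ A a b * (k + 1) := by
    intro a ha b hb
    rcases hA.zero_or_one a b with h | h
    · simp [h]
    · have := hA.two_mul_degIn_add_degIn ha hb h
      have := hA.degSum_nonneg ((H.erase a).erase b)
      rw [h]
      linarith
  have hsum : ∑ a ∈ H, ∑ b ∈ H, A a b * (k + 1) = 2 * k * (k + 1) := by
    simp only [← sum_mul]
    rw [← hk]
    rfl
  have hle' : ∀ a ∈ H, ∑ b ∈ H, A a b * (degIn A H a + degIn A H b) ≤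
    ∑ b ∈ H, A a b * (k + 1) := fun a ha => sum_le_sum fun b hb => hle a ha b hb
  have h1 := sum_le_sum hle'
  rw [hsum, hA.sum_degIn_sq] at h1
  refine ⟨by linarith, fun h2 a ha b hb hab => ?_⟩
  have h3 : ∑ a ∈ H, ∑ b ∈ H, A a b * (degIn A H a + degIn A H b) =
      ∑ a ∈ H, ∑ b ∈ H, A a b * (k + 1) := by
    rw [hsum, hA.sum_degIn_sq]
    linarith
  have h4 := (sum_eq_sum_iff_of_le (hle a ha)).1
    ((sum_eq_sum_iff_of_le hle').1 h3 a ha) b hb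
  have := hA.two_mul_degIn_add_degIn ha hb hab
  rw [hab] at h4
  linarith

theorem eq_zero_of_degSum_eq_zero {R : Finset V} (h : degSum A R = 0) {x y : V} (hx : x ∈ R)
    (hy : y ∈ R) : A x y = 0 := by
  have h1 := (sum_eq_zero_iff_of_nonneg fun v _ => hA.degIn_nonneg R v).1 h x hx
  exact (sum_eq_zero_iff_of_nonneg fun v _ => hA.nonneg x v).1 h1 y hy

/-- The matchings of `u, b, c, d` correspond to the edges among `b, c, d`, and the parity of x + y +
z for 0/1 values is x + y + z - 2(xy + yz + zx) + 4xyz. The quadratic terms count paths of length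
two, the cubic term triangles. -/
theorem tripleSum_of_dominating {H : Finset V} {u : V} (hu : ∀ x ∈ H, A u x = 1) :
    tripleSum H (matchParity A u) = 3 * (#H * degSum A H) - 6 * ∑ a ∈ H, degIn A H a ^ 2 +
      4 * tripleSum H fun b c d => A b c * A b d * A c d := by
  have key : ∀ b ∈ H, ∀ c ∈ H, ∀ d ∈ H, matchParity A u b c d = A c d + A b d + A b c -
      2 * (A b c * A b d) - 2 * (A b d * A c d) - 2 * (A b c * A c d) +
      4 * (A b c * A b d * A c d) := by
    intro b hb c hc d hd
    rw [matchParity, hu b hb, hu c hc, hu d hd]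
    rcases hA.zero_or_one b c with h | h <;> rcases hA.zero_or_one b d with h' | h' <;>
      rcases hA.zero_or_one c d with h'' | h'' <;> simp [h, h', h'']
  have e1 : ∑ b ∈ H, ∑ c ∈ H, ∑ d ∈ H, A c d = #H * degSum A H := by
    rw [sum_const, nsmul_eq_mul]; rfl
  have e2 : ∑ b ∈ H, ∑ c ∈ H, ∑ d ∈ H, A b d = #H * degSum A H := by
    simp only [sum_const, nsmul_eq_mul, ← mul_sum]; rfl
  have e3 : ∑ b ∈ H, ∑ c ∈ H, ∑ d ∈ H, A b c = #H * degSum A H := by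
    simp only [sum_const, nsmul_eq_mul, ← mul_sum]; rfl
  have e4 : ∑ b ∈ H, ∑ c ∈ H, ∑ d ∈ H, A b c * A b d = ∑ a ∈ H, degIn A H a ^ 2 :=
    sum_congr rfl fun b _ => by rw [← sum_mul_sum, sq]; rfl
  have e5 : ∑ b ∈ H, ∑ c ∈ H, ∑ d ∈ H, A b c * A c d = ∑ a ∈ H, degIn A H a ^ 2 := by
    rw [← e4, sum_comm]
    exact sum_congr rfl fun b _ => sum_congr rfl fun c _ => sum_congr rfl fun d _ => by
      rw [hA.symm]
  have e6 : ∑ b ∈ H, ∑ c ∈ H, ∑ d ∈ H, A b d * A c d = ∑ a ∈ H, degIn A H a ^ 2 := by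
    rw [← e5]
    refine sum_congr rfl fun b _ => ?_
    rw [sum_comm]
    exact sum_congr rfl fun b _ => sum_congr rfl fun c _ => by rw [hA.symm c]
  rw [tripleSum, sum_congr rfl fun b hb => sum_congr rfl fun c hc => sum_congr rfl fun d hd =>
    key b hb c hc d hd]
  simp only [← mul_sum] at e4 e5
  simp only [sum_add_distrib, sum_sub_distrib, ← mul_sum, tripleSum, e1, e2, e3, e4, e5, e6]
  ring

/-- Pairwise intersecting edges form a star or a triangle, and triangles are excluded. If neither
end of an edge `a b` is a centre, there are further edges at both ends, and these can meet only by
closing a triangle. -/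
theorem exists_mem_of_edges_meet {H : Finset V} (hpos : 0 < degSum A H)
    (hmeet : ∀ a ∈ H, ∀ b ∈ H, A a b = 1 → degSum A ((H.erase a).erase b) = 0)
    (htri : ∀ a ∈ H, ∀ b ∈ H, ∀ c ∈ H, A a b * A a c * A b c = 0) :
    ∃ q ∈ H, ∀ x ∈ H, ∀ y ∈ H, A x y = 1 → x = q ∨ y = q := by
  obtain ⟨a, ha, b, hb, hab⟩ : ∃ a ∈ H, ∃ b ∈ H, A a b = 1 := by
    by_contra! h
    refine hpos.ne' (sum_eq_zero fun a ha => sum_eq_zero fun b hb => ?_)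
    exact (hA.zero_or_one a b).resolve_right (h a ha b hb)
  have hmeet' : ∀ a ∈ H, ∀ b ∈ H, A a b = 1 → ∀ x ∈ H, ∀ y ∈ H, A x y = 1 →
      x = a ∨ x = b ∨ y = a ∨ y = b := by
    intro a ha b hb hab x hx y hy hxy
    by_contra! h
    have := hA.eq_zero_of_degSum_eq_zero (hmeet a ha b hb hab)
      (mem_erase.2 ⟨h.2.1, mem_erase.2 ⟨h.1, hx⟩⟩) (mem_erase.2 ⟨h.2.2.2, mem_erase.2 ⟨h.2.2.1, hy⟩⟩)
    omega
  by_contra! hcon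
  obtain ⟨x, hx, y, hy, hxy, hxa, hya⟩ := hcon a ha
  obtain ⟨z, hz, w, hw, hzw, hzb, hwb⟩ := hcon b hb
  have hba : A b a = 1 := by rw [hA.symm, hab]
  obtain ⟨y', hy', hby, hya'⟩ : ∃ y ∈ H, A b y = 1 ∧ y ≠ a := by
    rcases hmeet' a ha b hb hab x hx y hy hxy with h | h | h | h
    · exact absurd h hxa
    · exact ⟨y, hy, h ▸ hxy, hya⟩
    · exact absurd h hya
    · exact ⟨x, hx, by rw [hA.symm, ← h, hxy], hxa⟩
  obtain ⟨w', hw', haw, hwb'⟩ : ∃ y ∈ H, A a y = 1 ∧ y ≠ b := by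
    rcases hmeet' a ha b hb hab z hz w hw hzw with h | h | h | h
    · exact ⟨w, hw, h ▸ hzw, hwb⟩
    · exact absurd h hzb
    · exact ⟨z, hz, by rw [hA.symm, ← h, hzw], hzb⟩
    · exact absurd h hwb
  rcases hmeet' a ha w' hw' haw b hb y' hy' hby with h | h | h | h
  · exact hA.ne_of_eq_one hba h
  · exact hwb' h.symm
  · exact hya' h
  · have := htri a ha b hb w' hw'
    rw [hab, haw, ← h, hby] at this
    norm_num at this

/-- Deleting `u` leaves k edges, so `tripleSum_of_dominating` and Σ deg² ≤ k(k+1) give 4(6k(n-1) -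
6k(k+1)). Equality excludes triangles and disjoint edges outside `u`, so these edges form a star,
whose centre serves as the second centre. -/
theorem le_quadSum_of_dominating {S : Finset V} {u : V} (hu : u ∈ S)
    (hdom : ∀ x ∈ S, x ≠ u → A u x = 1) {n k : ℤ} (hn : #S = n)
    (hm : degSum A S = 2 * (k + n - 1)) :
    24 * (k * (n - 2 - k)) ≤ quadSum S (matchParity A) ∧
      (1 ≤ k → quadSum S (matchParity A) ≤ 24 * (k * (n - 2 - k)) → IsDoubleStar A S) := by
  set H := S.erase u with hH
  have hdom' : ∀ x ∈ H, A u x = 1 := fun x hx => hdom x (mem_of_mem_erase hx) (ne_of_mem_erase hx)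
  have hcard : (#H : ℤ) = n - 1 := by
    have := card_erase_add_one hu
    rw [← hn, ← this]
    push_cast
    ring
  have hdeg : degIn A S u = n - 1 := by
    rw [hA.degIn_erase hu, hA.self, ← hcard, degIn, sum_congr rfl hdom']
    simp [H]
  have hk : degSum A H = 2 * k := by
    have := hA.degSum_erase hu
    rw [hm, hdeg] at this
    linarith
  have hB := hA.isAlternatingSymm.quadSum_erase hu
  rw [hA.tripleSum_of_dominating hdom', hcard, hk] at hB
  have h0 := quadSum_nonneg (matchParity_nonneg hA) H
  have htri : ∀ b c d, 0 ≤ A b c * A b d * A c d := fun b c d =>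
    mul_nonneg (mul_nonneg (hA.nonneg _ _) (hA.nonneg _ _)) (hA.nonneg _ _)
  have h1 := tripleSum_nonneg htri H
  obtain ⟨h2, h3⟩ := hA.sum_degIn_sq_le hk
  refine ⟨by linarith, fun hk1 hle => ?_⟩
  have h4 : k * (k + 1) ≤ ∑ a ∈ H, degIn A H a ^ 2 := by linarith
  have h5 : tripleSum H (fun b c d => A b c * A b d * A c d) = 0 := by linarith
  obtain ⟨q, hq, hqs⟩ := hA.exists_mem_of_edges_meet (by linarith : 0 < degSum A H) (h3 h4) (by
    intro a ha b hb c hc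
    have i1 := (sum_eq_zero_iff_of_nonneg fun b _ => sum_nonneg fun c _ =>
      sum_nonneg fun d _ => htri b c d).1 h5 a ha
    have i2 := (sum_eq_zero_iff_of_nonneg fun c _ => sum_nonneg fun d _ => htri a c d).1 i1 b hb
    exact (sum_eq_zero_iff_of_nonneg fun d _ => htri a b d).1 i2 c hc)
  refine ⟨u, hu, q, mem_of_mem_erase hq, (ne_of_mem_erase hq).symm,
    fun x hx hxu _ => hdom x hx hxu, fun x hx y hy hxu hyu hxy => ?_⟩
  exact hqs x (mem_erase.2 ⟨hxu, hx⟩) y (mem_erase.2 ⟨hyu, hy⟩) hxy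

end IsAdjFun

/-! ### The lower bound for odd quadruples, by vertex deletion. -/

/-- There are no isolated vertices and no isolated edges inside `S`. -/
def HasNoSmallComponent {V : Type*} (A : V → V → ℤ) (S : Finset V) : Prop :=
  ∀ u ∈ S, 1 ≤ degIn A S u ∧ ∀ v ∈ S, A u v = 1 → 3 ≤ degIn A S u + degIn A S v

/-- The neighbours of `v` in `S`. -/
def nbrs {V : Type*} [DecidableEq V] (A : V → V → ℤ) (S : Finset V) (v : V) : Finset V :=
  (S.erase v).filter (A v · = 1)

/-- The vertices of `S` other than `v` that are not adjacent to `v`. -/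
def nonNbrs {V : Type*} [DecidableEq V] (A : V → V → ℤ) (S : Finset V) (v : V) : Finset V :=
  (S.erase v).filter (A v · = 0)

namespace IsAdjFun

variable {V : Type*} {A : V → V → ℤ} (hA : IsAdjFun A) [DecidableEq V]
include hA

theorem disjoint_nbrs (S : Finset V) (v : V) : Disjoint (nbrs A S v) (nonNbrs A S v) := by
  rw [disjoint_left]
  simp only [nbrs, nonNbrs, mem_filter]
  rintro x ⟨-, h⟩ ⟨-, h'⟩
  omega

theorem erase_eq_nbrs_union (S : Finset V) (v : V) :
    S.erase v = nbrs A S v ∪ nonNbrs A S v := by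
  ext x
  have := hA.zero_or_one v x
  simp only [nbrs, nonNbrs, mem_union, mem_filter]
  tauto

theorem degIn_eq_card_nbrs {S : Finset V} {v : V} (hv : v ∈ S) :
    degIn A S v = #(nbrs A S v) := by
  rw [hA.degIn_erase hv, hA.self, hA.degIn_eq_card, nbrs, add_zero]

theorem card_eq_nbrs_add {S : Finset V} {v : V} (hv : v ∈ S) :
    (#S : ℤ) = 1 + #(nbrs A S v) + #(nonNbrs A S v) := by
  rw [← card_erase_add_one hv, hA.erase_eq_nbrs_union, card_union_of_disjoint (hA.disjoint_nbrs S v)]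
  push_cast
  ring

theorem degSum_eq_nbrs_add {S : Finset V} {v : V} (hv : v ∈ S) :
    degSum A S = 2 * degIn A S v + degSum A (nbrs A S v) +
      2 * ∑ z ∈ nonNbrs A S v, degIn A (nbrs A S v) z + degSum A (nonNbrs A S v) := by
  rw [hA.degSum_erase hv, hA.erase_eq_nbrs_union, hA.degSum_union (hA.disjoint_nbrs S v)]
  ring

theorem degIn_of_mem_nonNbrs {S : Finset V} {v z : V} (hv : v ∈ S) (hz : z ∈ nonNbrs A S v) :
    degIn A S z = degIn A (nbrs A S v) z + degIn A (nonNbrs A S v) z := by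
  rw [hA.degIn_erase hv, hA.erase_eq_nbrs_union, hA.degIn_union (hA.disjoint_nbrs S v),
    hA.symm v z, (mem_filter.1 hz).2, add_zero]

theorem degIn_le_card (S : Finset V) (v : V) : degIn A S v ≤ #S := by
  rw [hA.degIn_eq_card]
  exact_mod_cast card_filter_le _ _

theorem degIn_le_card_sub_one {S : Finset V} {v : V} (hv : v ∈ S) : degIn A S v ≤ #S - 1 := by
  have h1 := hA.degIn_le_card (S.erase v) v
  rw [hA.degIn_erase hv, hA.self, ← card_erase_add_one hv]
  push_cast
  linarith

theorem degSum_le_card_mul {S : Finset V} {c : ℤ} (h : ∀ x ∈ S, degIn A S x ≤ c) :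
    degSum A S ≤ #S * c := by
  have := sum_le_card_nsmul S _ c h
  rwa [nsmul_eq_mul] at this

theorem card_mul_le_degSum {S : Finset V} {c : ℤ} (h : ∀ x ∈ S, c ≤ degIn A S x) :
    #S * c ≤ degSum A S := by
  have := card_nsmul_le_sum S _ c h
  rwa [nsmul_eq_mul] at this

theorem two_mul_degIn_le {S : Finset V} {v : V} (hv : v ∈ S) : 2 * degIn A S v ≤ degSum A S := by
  have h1 := hA.degSum_erase hv
  have h2 := hA.degSum_nonneg (S.erase v)
  linarith

theorem add_le_degIn {S : Finset V} {v a b : V} (ha : a ∈ S) (hb : b ∈ S) (hab : a ≠ b) :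
    A v a + A v b ≤ degIn A S v := by
  rw [hA.degIn_erase ha, hA.degIn_erase (mem_erase.2 ⟨hab.symm, hb⟩)]
  have := hA.degIn_nonneg ((S.erase a).erase b) v
  linarith

theorem eq_of_degIn_le_one {S : Finset V} {v a b : V} (ha : a ∈ S) (hb : b ∈ S)
    (hva : A v a = 1) (hvb : A v b = 1) (hd : degIn A S v ≤ 1) : a = b := by
  by_contra h
  have := hA.add_le_degIn (v := v) ha hb h
  omega

theorem eq_or_eq_of_degIn_le_two {S : Finset V} {v a b c : V} (ha : a ∈ S) (hb : b ∈ S)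
    (hc : c ∈ S) (hab : a ≠ b) (hva : A v a = 1) (hvb : A v b = 1) (hvc : A v c = 1)
    (hd : degIn A S v ≤ 2) : c = a ∨ c = b := by
  by_contra! h
  rw [hA.degIn_erase hc] at hd
  have := hA.add_le_degIn (v := v) (mem_erase.2 ⟨h.1.symm, ha⟩) (mem_erase.2 ⟨h.2.symm, hb⟩) hab
  omega

/-- The edge `v u` forms an odd quadruple with every edge that avoids `u`, because `v` can be
matched only to `u`. -/
theorem quadSum_pendant_le {S : Finset V} {u v : V} (hv : v ∈ S) (hu : u ∈ S) (hvu : A v u = 1)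
    (hd : degIn A S v = 1) :
    quadSum (S.erase v) (matchParity A) + 12 * (degSum A S - 2 * degIn A S u) ≤
      quadSum S (matchParity A) := by
  have h1 := hA.quadSum_erase_le hv rfl rfl
  have hne := hA.ne_of_eq_one hvu
  have hR : nonNbrs A S v = (S.erase v).erase u := by
    ext x
    simp only [nonNbrs, mem_filter, mem_erase]
    constructor
    · rintro ⟨⟨h1, h2⟩, h3⟩
      refine ⟨?_, h1, h2⟩
      rintro rfl
      omega
    · rintro ⟨h1, h2, h3⟩
      refine ⟨⟨h2, h3⟩, (hA.zero_or_one v x).resolve_right fun h => ?_⟩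
      exact h1 (hA.eq_of_degIn_le_one h3 hu h hvu hd.le)
  have h2 : 0 ≤ ∑ z ∈ nonNbrs A S v, degIn A (nbrs A S v) z *
      (degIn A S v - degIn A (nbrs A S v) z) := by
    refine sum_nonneg fun z _ => mul_nonneg (hA.degIn_nonneg _ _) ?_
    have := hA.degIn_le_card (nbrs A S v) z
    rw [hA.degIn_eq_card_nbrs hv]
    linarith
  have h3 := hA.degSum_erase hv
  have h4 := hA.degSum_erase (mem_erase.2 ⟨hne.symm, hu⟩)
  have h5 := hA.degIn_erase hv u
  rw [hA.symm v u, hvu] at h5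
  change quadSum (S.erase v) (matchParity A) + 12 * (degIn A S v * degSum A (nonNbrs A S v) +
      2 * ∑ z ∈ nonNbrs A S v, degIn A (nbrs A S v) z * (degIn A S v - degIn A (nbrs A S v) z)) ≤ _
    at h1
  rw [hd, hR] at h1
  rw [hd, hR] at h2
  linarith

theorem hasNoSmallComponent_of_degIn_eq {S T : Finset V} (hS : HasNoSmallComponent A S)
    (hTS : T ⊆ S) (h : ∀ x ∈ T, degIn A T x = degIn A S x) : HasNoSmallComponent A T := by
  intro u hu
  rw [h u hu]
  refine ⟨(hS u (hTS hu)).1, fun v hv huv => ?_⟩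
  rw [h v hv]
  exact (hS u (hTS hu)).2 v (hTS hv) huv

/-- Only neighbours of `v` lose degree. On an edge `u x` with `u` adjacent to `v`, the end `u` loses
one and `x` loses `A x v`, so the 4 leaves the required 3. -/
theorem hasNoSmallComponent_erase {S : Finset V} {v : V} (hS : HasNoSmallComponent A S)
    (hv : v ∈ S) (h : ∀ u ∈ S, A u v = 1 → 2 ≤ degIn A S u ∧
      ∀ x ∈ S, x ≠ v → A u x = 1 → 4 ≤ degIn A S u + degIn A S x - A x v) :
    HasNoSmallComponent A (S.erase v) := by
  intro u hu
  have hu' := mem_of_mem_erase hu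
  have e1 := hA.degIn_erase hv u
  refine ⟨?_, fun x hx hux => ?_⟩
  · rcases hA.zero_or_one u v with h0 | h1
    · have := (hS u hu').1
      linarith
    · have := (h u hu' h1).1
      linarith
  · have hx' := mem_of_mem_erase hx
    have e2 := hA.degIn_erase hv x
    rcases hA.zero_or_one u v with h0 | h1
    · rcases hA.zero_or_one x v with h0' | h1'
      · have := (hS u hu').2 x hx' hux
        linarith
      · have := (h x hx' h1').2 u hu' (ne_of_mem_erase hu) (by rw [hA.symm, hux])
        linarith
    · have := (h u hu' h1).2 x hx' (ne_of_mem_erase hx) hux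
      linarith

end IsAdjFun

/-- The lower bound for the number of odd quadruples, with the case of equality. -/
def QuadBound {V : Type*} (A : V → V → ℤ) (S : Finset V) (n k : ℤ) : Prop :=
  (24 * (k * (n - 2 - k)) ≤ quadSum S (matchParity A) ∨
    24 * ((k + 1) * (n - 3 - k)) ≤ quadSum S (matchParity A)) ∧
  (1 ≤ k → k ≤ n - 4 → quadSum S (matchParity A) ≤ 24 * (k * (n - 2 - k)) →
    quadSum S (matchParity A) ≤ 24 * ((k + 1) * (n - 3 - k)) → IsDoubleStar A S)

/-- For deletions whose gain is strictly more than needed: both alternatives are exceeded, so the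
equality clause is vacuous. -/
theorem quadBound_of_strict {V : Type*} {A : V → V → ℤ} {S : Finset V} {n k : ℤ}
    (h : quadSum S (matchParity A) ≤ 24 * (k * (n - 2 - k)) →
      quadSum S (matchParity A) ≤ 24 * ((k + 1) * (n - 3 - k)) → False) : QuadBound A S n k := by
  refine ⟨?_, fun _ _ h1 h2 => (h h1 h2).elim⟩
  by_contra! hc
  exact h hc.1.le hc.2.le

namespace IsAdjFun

variable {V : Type*} {A : V → V → ℤ} (hA : IsAdjFun A) [DecidableEq V]
include hA

theorem quadBound_of_degIn_two {S : Finset V} {v : V} {n k : ℤ} (hn : #S = n)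
    (hm : degSum A S = 2 * (k + n - 1)) (hk : k ≤ n - 4) (hmin : ∀ x ∈ S, 2 ≤ degIn A S x)
    (hv : v ∈ S) (hd : degIn A S v = 2) (ih : QuadBound A (S.erase v) (n - 1) (k - 1)) :
    QuadBound A S n k := by
  have hcount := hA.quadSum_erase_le hv rfl rfl
  change quadSum (S.erase v) (matchParity A) + 12 * (degIn A S v * degSum A (nonNbrs A S v) +
      2 * ∑ z ∈ nonNbrs A S v, degIn A (nbrs A S v) z * (degIn A S v - degIn A (nbrs A S v) z)) ≤ _
    at hcount
  have hcard := hA.card_eq_nbrs_add hv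
  have hsum := hA.degSum_eq_nbrs_add hv
  have hN := hA.degIn_eq_card_nbrs hv
  have hN0 := hA.degSum_nonneg (nbrs A S v)
  have hz := fun z hz => hA.degIn_of_mem_nonNbrs hv (z := z) hz
  have ht0 := hA.degIn_nonneg (nbrs A S v)
  have ht2 := hA.degIn_le_card (nbrs A S v)
  have hR2 := fun z hz => hA.two_mul_degIn_le (S := nonNbrs A S v) (v := z) hz
  have hRmem : ∀ z ∈ nonNbrs A S v, z ∈ S := fun z hz => mem_of_mem_erase (mem_filter.1 hz).1
  set N := nbrs A S v
  set R := nonNbrs A S v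
  rw [← hN, hd] at ht2 hcard
  rw [hd] at hcount hsum
  -- Each non-neighbour of `v` has degree at least 2, and what it does not send to `N` it sends to
  -- `R`.
  have hτ : 2 * (#R : ℤ) - ∑ z ∈ R, degIn A N z ≤ degSum A R := by
    have : ∑ z ∈ R, (2 - degIn A N z) ≤ degSum A R :=
      sum_le_sum fun z h => by linarith [hz z h, hmin z (hRmem z h)]
    rw [sum_sub_distrib, sum_const, nsmul_eq_mul] at this
    linarith
  -- If `R` had no edge, each of its vertices would be joined to both vertices of `N`, giving more
  -- edges than k ≤ n - 4 allows. Evenness of `degSum A N` makes the parity argument work.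
  have hpos : 2 ≤ degSum A R := by
    by_contra! h
    have h0 : 2 * (#R : ℤ) - 1 ≤ ∑ z ∈ R, degIn A N z := by linarith
    obtain ⟨c, hc⟩ : ∃ c, degSum A N = 2 * c := by
      obtain ⟨a, b, hab, hN'⟩ := card_eq_two.1 (by exact_mod_cast hN ▸ hd : #N = 2)
      refine ⟨A a b, ?_⟩
      rw [hN']
      simp only [degSum, degIn, sum_pair hab, hA.self, hA.symm a b]
      ring
    omega
  -- After substituting the edge count, this says that the gain exceeds 24(n-2-k), the larger of the
  -- two increments needed. The expression t(2-t) + t - 2 vanishes at t = 1, 2 and is -2 at t = 0; a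
  -- vertex with t = 0 has degree at least 2 in `R`, which pays for the loss.
  have hX : 4 * (#R : ℤ) + 2 < 3 * degSum A R + 2 * ∑ z ∈ R, degIn A N z * (2 - degIn A N z) +
      2 * ∑ z ∈ R, degIn A N z := by
    have hw : ∑ z ∈ R, (degIn A N z * (2 - degIn A N z) + degIn A N z - 2) =
        ∑ z ∈ R, degIn A N z * (2 - degIn A N z) + ∑ z ∈ R, degIn A N z - 2 * #R := by
      simp only [sum_sub_distrib, sum_add_distrib, sum_const, nsmul_eq_mul]
      ring
    by_cases h0 : ∃ z ∈ R, degIn A N z = 0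
    · obtain ⟨z, hzR, hz0⟩ := h0
      have h4 := hR2 z hzR
      have h5 := hz z hzR
      have h6 := hmin z (hRmem z hzR)
      have h7 : -degSum A R ≤
          ∑ z ∈ R, (degIn A N z * (2 - degIn A N z) + degIn A N z - 2) := by
        rw [degSum, ← sum_neg_distrib]
        refine sum_le_sum fun y hy => ?_
        have := hz y hy
        have := hmin y (hRmem y hy)
        have := ht0 y
        have := ht2 y
        have := hA.degIn_nonneg R y
        have : degIn A N y = 0 ∨ degIn A N y = 1 ∨ degIn A N y = 2 := by omega
        rcases this with h | h | h <;> rw [h] <;> linarith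
      linarith
    · push Not at h0
      have h7 : 0 ≤ ∑ z ∈ R, (degIn A N z * (2 - degIn A N z) + degIn A N z - 2) := by
        refine sum_nonneg fun y hy => ?_
        have := h0 y hy
        have := ht0 y
        have := ht2 y
        have : degIn A N y = 1 ∨ degIn A N y = 2 := by omega
        rcases this with h | h <;> rw [h] <;> norm_num
      linarith
  refine quadBound_of_strict fun h1 h2 => ?_
  rcases ih.1 with h | h
  · linarith
  · linarith

/-- With minimum degree 3 the edges within `R` alone give a sufficient gain; the terms for
quadruples with two neighbours of `v` are only needed to be nonnegative. -/
theorem quadBound_of_degIn_three {S : Finset V} {v : V} {n k : ℤ} (hn : #S = n)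
    (hm : degSum A S = 2 * (k + n - 1)) (hk : k ≤ n - 4) (hmin : ∀ x ∈ S, 3 ≤ degIn A S x)
    (hv : v ∈ S) (hd : degIn A S v = 3) (ih : QuadBound A (S.erase v) (n - 1) (k - 2)) :
    QuadBound A S n k := by
  have hcount := hA.quadSum_erase_le hv rfl rfl
  change quadSum (S.erase v) (matchParity A) + 12 * (degIn A S v * degSum A (nonNbrs A S v) +
      2 * ∑ z ∈ nonNbrs A S v, degIn A (nbrs A S v) z * (degIn A S v - degIn A (nbrs A S v) z)) ≤ _
    at hcount
  have hcard := hA.card_eq_nbrs_add hv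
  have hsum := hA.degSum_eq_nbrs_add hv
  have hN := hA.degIn_eq_card_nbrs hv
  have hN0 := hA.degSum_nonneg (nbrs A S v)
  have hz := fun z hz => hA.degIn_of_mem_nonNbrs hv (z := z) hz
  have ht0 := hA.degIn_nonneg (nbrs A S v)
  have ht3 := hA.degIn_le_card (nbrs A S v)
  have hRmem : ∀ z ∈ nonNbrs A S v, z ∈ S := fun z hz => mem_of_mem_erase (mem_filter.1 hz).1
  have hlarge := hA.card_mul_le_degSum hmin
  set N := nbrs A S v
  set R := nonNbrs A S v
  rw [← hN, hd] at ht3 hcard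
  rw [hd] at hcount hsum
  have hτ : 3 * (#R : ℤ) - ∑ z ∈ R, degIn A N z ≤ degSum A R := by
    have : ∑ z ∈ R, (3 - degIn A N z) ≤ degSum A R :=
      sum_le_sum fun z h => by linarith [hz z h, hmin z (hRmem z h)]
    rw [sum_sub_distrib, sum_const, nsmul_eq_mul] at this
    linarith
  have hπ : 0 ≤ ∑ z ∈ R, degIn A N z * (3 - degIn A N z) :=
    sum_nonneg fun z _ => mul_nonneg (ht0 z) (by linarith [ht3 z])
  refine quadBound_of_strict fun h1 h2 => ?_
  rcases ih.1 with h | h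
  · linarith
  · linarith

/-- Deleting the leaf `v` alone would leave the isolated edge `u w`. The component has three
vertices but two edges, so the parameter rises to k + 1. -/
theorem quadBound_of_path_component {S : Finset V} {u v w : V} {n k : ℤ} (hn : #S = n)
    (hm : degSum A S = 2 * (k + n - 1)) (hk1 : 1 ≤ k) (hk : k ≤ n - 4)
    (hS : HasNoSmallComponent A S) (hu : u ∈ S) (hv : v ∈ S) (hw : w ∈ S) (hvw : v ≠ w)
    (huv : A u v = 1) (huw : A u w = 1) (hdu : degIn A S u = 2) (hdv : degIn A S v = 1)
    (hdw : degIn A S w = 1)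
    (ih : HasNoSmallComponent A (((S.erase v).erase w).erase u) →
      degSum A (((S.erase v).erase w).erase u) = degSum A S - 4 →
      (#(((S.erase v).erase w).erase u) : ℤ) = n - 3 →
      QuadBound A (((S.erase v).erase w).erase u) (n - 3) (k + 1)) :
    QuadBound A S n k := by
  have hvu : A v u = 1 := by rw [hA.symm, huv]
  have hwu : A w u = 1 := by rw [hA.symm, huw]
  have huv' := hA.ne_of_eq_one huv
  have huw' := hA.ne_of_eq_one huw
  have hwv : A w v = 0 := (hA.zero_or_one w v).resolve_right fun h =>
    huv' (hA.eq_of_degIn_le_one hu hv hwu h hdw.le)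
  have hw1 : w ∈ S.erase v := mem_erase.2 ⟨hvw.symm, hw⟩
  have hu1 : u ∈ S.erase v := mem_erase.2 ⟨huv', hu⟩
  have hu2 : u ∈ (S.erase v).erase w := mem_erase.2 ⟨huw', hu1⟩
  have b1 := hA.quadSum_pendant_le hv hu hvu hdv
  have d1 := hA.degIn_erase hv w
  have d2 := hA.degIn_erase hv u
  have d3 := hA.degIn_erase hw1 u
  have b2 := hA.quadSum_pendant_le hw1 hu1 hwu (by linarith)
  have b3 := quadSum_mono (hA.matchParity_nonneg) (erase_subset u ((S.erase v).erase w))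
  have s1 := hA.degSum_erase hv
  have s2 := hA.degSum_erase hw1
  have s3 := hA.degSum_erase hu2
  have c1 := card_erase_add_one hv
  have c2 := card_erase_add_one hw1
  have c3 := card_erase_add_one hu2
  set T := ((S.erase v).erase w).erase u
  have hTS : T ⊆ S := (erase_subset _ _).trans ((erase_subset _ _).trans (erase_subset _ _))
  have hT : HasNoSmallComponent A T := by
    refine hA.hasNoSmallComponent_of_degIn_eq hS hTS fun x hx => ?_
    simp only [T, mem_erase] at hx
    obtain ⟨hxu, hxw, hxv, hxS⟩ := hx
    have z1 : A x v = 0 := (hA.zero_or_one x v).resolve_right fun h =>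
      hxu (hA.eq_of_degIn_le_one hxS hu (by rw [hA.symm, h]) hvu hdv.le)
    have z2 : A x w = 0 := (hA.zero_or_one x w).resolve_right fun h =>
      hxu (hA.eq_of_degIn_le_one hxS hu (by rw [hA.symm, h]) hwu hdw.le)
    have z3 : A x u = 0 := (hA.zero_or_one x u).resolve_right fun h => by
      rcases hA.eq_or_eq_of_degIn_le_two hv hw hxS hvw huv huw (by rw [hA.symm, h]) hdu.le with h | h
      · exact hxv h
      · exact hxw h
    rw [hA.degIn_erase hv x, hA.degIn_erase hw1 x, hA.degIn_erase hu2 x, z1, z2, z3]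
    simp [T]
  have ih' := ih hT (by linarith) (by omega)
  have h0 := quadSum_nonneg hA.matchParity_nonneg T
  refine quadBound_of_strict fun h1 h2 => ?_
  -- For k = n - 5 and k = n - 4 the gain from the two leaves already suffices, and the remaining
  -- sum need only be nonnegative.
  by_cases hk6 : k ≤ n - 6
  · rcases ih'.1 with h | h
    · linarith
    · linarith
  · obtain rfl | rfl : n = k + 5 ∨ n = k + 4 := by omega
    · linarith
    · linarith

/-- Deleting one vertex of the triangle would leave an isolated edge. The component has as many
edges as vertices, so k is unchanged. -/
theorem quadBound_of_triangle_component {S : Finset V} {u v w : V} {n k : ℤ} (hn : #S = n)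
    (hm : degSum A S = 2 * (k + n - 1)) (hk1 : 1 ≤ k) (hk : k ≤ n - 4)
    (hS : HasNoSmallComponent A S) (hu : u ∈ S) (hv : v ∈ S) (hw : w ∈ S)
    (huv : A u v = 1) (huw : A u w = 1) (hvw : A v w = 1) (hdu : degIn A S u = 2)
    (hdv : degIn A S v = 2) (hdw : degIn A S w = 2)
    (ih : HasNoSmallComponent A (((S.erase v).erase w).erase u) →
      degSum A (((S.erase v).erase w).erase u) = degSum A S - 6 →
      (#(((S.erase v).erase w).erase u) : ℤ) = n - 3 →
      QuadBound A (((S.erase v).erase w).erase u) (n - 3) k) :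
    QuadBound A S n k := by
  have hvu : A v u = 1 := by rw [hA.symm, huv]
  have hwu : A w u = 1 := by rw [hA.symm, huw]
  have hwv : A w v = 1 := by rw [hA.symm, hvw]
  have huv' := hA.ne_of_eq_one huv
  have huw' := hA.ne_of_eq_one huw
  have hvw' := hA.ne_of_eq_one hvw
  have hw1 : w ∈ S.erase v := mem_erase.2 ⟨hvw'.symm, hw⟩
  have hu1 : u ∈ S.erase v := mem_erase.2 ⟨huv', hu⟩
  have hu2 : u ∈ (S.erase v).erase w := mem_erase.2 ⟨huw', hu1⟩
  have hR : nonNbrs A S v = ((S.erase v).erase w).erase u := by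
    ext x
    simp only [nonNbrs, mem_filter, mem_erase]
    constructor
    · rintro ⟨⟨h1, h2⟩, h3⟩
      refine ⟨?_, ?_, h1, h2⟩ <;> rintro rfl <;> omega
    · rintro ⟨h1, h2, h3, h4⟩
      refine ⟨⟨h3, h4⟩, (hA.zero_or_one v x).resolve_right fun h => ?_⟩
      rcases hA.eq_or_eq_of_degIn_le_two hu hw h4 huw' hvu hvw h hdv.le with h | h
      · exact h1 h
      · exact h2 h
  have b1 := hA.quadSum_erase_le hv rfl rfl
  change quadSum (S.erase v) (matchParity A) + 12 * (degIn A S v * degSum A (nonNbrs A S v) +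
      2 * ∑ z ∈ nonNbrs A S v, degIn A (nbrs A S v) z * (degIn A S v - degIn A (nbrs A S v) z)) ≤ _
    at b1
  have hπ : 0 ≤ ∑ z ∈ nonNbrs A S v, degIn A (nbrs A S v) z *
      (degIn A S v - degIn A (nbrs A S v) z) := by
    refine sum_nonneg fun z _ => mul_nonneg (hA.degIn_nonneg _ _) ?_
    have := hA.degIn_le_card (nbrs A S v) z
    rw [hA.degIn_eq_card_nbrs hv]
    linarith
  have d1 := hA.degIn_erase hv w
  have d2 := hA.degIn_erase hv u
  have d3 := hA.degIn_erase hw1 u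
  have b2 := hA.quadSum_pendant_le hw1 hu1 hwu (by linarith)
  have b3 := quadSum_mono (hA.matchParity_nonneg) (erase_subset u ((S.erase v).erase w))
  have s1 := hA.degSum_erase hv
  have s2 := hA.degSum_erase hw1
  have s3 := hA.degSum_erase hu2
  have c1 := card_erase_add_one hv
  have c2 := card_erase_add_one hw1
  have c3 := card_erase_add_one hu2
  rw [hR, hdv] at b1
  rw [hR, hdv] at hπ
  set T := ((S.erase v).erase w).erase u
  have hTS : T ⊆ S := (erase_subset _ _).trans ((erase_subset _ _).trans (erase_subset _ _))
  have hT : HasNoSmallComponent A T := by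
    refine hA.hasNoSmallComponent_of_degIn_eq hS hTS fun x hx => ?_
    simp only [T, mem_erase] at hx
    obtain ⟨hxu, hxw, hxv, hxS⟩ := hx
    have z1 : A x v = 0 := (hA.zero_or_one x v).resolve_right fun h => by
      rcases hA.eq_or_eq_of_degIn_le_two hu hw hxS huw' hvu hvw (by rw [hA.symm, h]) hdv.le with h | h
      · exact hxu h
      · exact hxw h
    have z2 : A x w = 0 := (hA.zero_or_one x w).resolve_right fun h => by
      rcases hA.eq_or_eq_of_degIn_le_two hu hv hxS huv' hwu hwv (by rw [hA.symm, h]) hdw.le with h | h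
      · exact hxu h
      · exact hxv h
    have z3 : A x u = 0 := (hA.zero_or_one x u).resolve_right fun h => by
      rcases hA.eq_or_eq_of_degIn_le_two hv hw hxS hvw' huv huw (by rw [hA.symm, h]) hdu.le with h | h
      · exact hxv h
      · exact hxw h
    rw [hA.degIn_erase hv x, hA.degIn_erase hw1 x, hA.degIn_erase hu2 x, z1, z2, z3]
    simp [T]
  have hcT : (#T : ℤ) = n - 3 := by omega
  have hsT : degSum A T = degSum A S - 6 := by linarith
  -- For n = 5 the two remaining vertices would have degree sum 4, but a single edge gives only 2.
  have hn6 : 6 ≤ n := by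
    by_contra! h
    obtain ⟨rfl, rfl⟩ : n = 5 ∧ k = 1 := by omega
    have := hA.degSum_le_card_mul fun x hx => hA.degIn_le_card_sub_one (S := T) hx
    rw [hcT] at this
    linarith
  have ih' := ih hT hsT hcT
  refine quadBound_of_strict fun h1 h2 => ?_
  rcases ih'.1 with h | h
  · linarith
  · linarith

end IsAdjFun

namespace IsAdjFun

variable {V : Type*} {A : V → V → ℤ} (hA : IsAdjFun A) [DecidableEq V]
include hA

theorem isDoubleStar_of_erase_pendant {S : Finset V} {v p q : V} (hp : p ∈ S.erase v)
    (hq : q ∈ S.erase v) (hpq : p ≠ q) (hvp : A v p = 1) (hd : degIn A S v = 1)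
    (hdom : ∀ x ∈ S.erase v, x ≠ p → x ≠ q → A p x = 1)
    (hcov : ∀ x ∈ S.erase v, ∀ y ∈ S.erase v, x ≠ p → y ≠ p → A x y = 1 → x = q ∨ y = q) :
    IsDoubleStar A S := by
  have hp' := mem_of_mem_erase hp
  have hv0 : ∀ x ∈ S, x ≠ p → A v x ≠ 1 := fun x hx hxp h =>
    hxp (hA.eq_of_degIn_le_one hx hp' h hvp hd.le)
  refine ⟨p, hp', q, mem_of_mem_erase hq, hpq, fun x hx hxp hxq => ?_,
    fun x hx y hy hxp hyp hxy => ?_⟩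
  · by_cases hxv : x = v
    · rw [hxv, hA.symm, hvp]
    · exact hdom x (mem_erase.2 ⟨hxv, hx⟩) hxp hxq
  · by_cases hxv : x = v
    · exact absurd (hxv ▸ hxy) (hv0 y hy hyp)
    · by_cases hyv : y = v
      · exact absurd (by rw [hA.symm, ← hyv, hxy]) (hv0 x hx hxp)
      · exact hcov x (mem_erase.2 ⟨hxv, hx⟩) y (mem_erase.2 ⟨hyv, hy⟩) hxp hyp hxy

/-- In a double star with few edges, only `p` can miss exactly one other vertex. -/
theorem eq_of_doubleStar {S : Finset V} {p q u : V} {n k : ℤ} (hn : #S = n)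
    (hm : degSum A S = 2 * (k + n - 1)) (hk1 : 1 ≤ k) (hk : k ≤ n - 4) (hp : p ∈ S) (hq : q ∈ S)
    (hpq : p ≠ q) (hdom : ∀ x ∈ S, x ≠ p → x ≠ q → A p x = 1)
    (hcov : ∀ x ∈ S, ∀ y ∈ S, x ≠ p → y ≠ p → A x y = 1 → x = q ∨ y = q) (hu : u ∈ S)
    (hd : degIn A S u = n - 2) : u = p := by
  by_contra hup
  have hq1 : q ∈ S.erase p := mem_erase.2 ⟨hpq.symm, hq⟩
  have e1 := hA.degSum_erase hp
  have e2 := hA.degSum_erase hq1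
  have e3 := hA.degIn_erase hq p
  have e4 := hA.degIn_erase hp q
  have c1 := card_erase_add_one hp
  have c2 := card_erase_add_one hq1
  have hz : ∀ x ∈ (S.erase p).erase q, ∀ y ∈ (S.erase p).erase q, A x y = 0 := by
    intro x hx y hy
    simp only [mem_erase] at hx hy
    refine (hA.zero_or_one x y).resolve_right fun h => ?_
    rcases hcov x hx.2.2 y hy.2.2 hx.2.1 hy.2.1 h with h | h
    · exact hx.1 h
    · exact hy.1 h
  have e5 : degSum A ((S.erase p).erase q) = 0 :=
    sum_eq_zero fun x hx => sum_eq_zero fun y hy => hz x hx y hy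
  have e6 : degIn A ((S.erase p).erase q) p = n - 2 := by
    rw [degIn, sum_congr rfl (g := fun _ => 1)]
    · simp only [sum_const, nsmul_eq_mul, mul_one]
      omega
    · intro x hx
      simp only [mem_erase] at hx
      exact hdom x hx.2.2 hx.2.1 hx.1
  have e7 := hA.degIn_erase hp p
  have e8 := hA.degIn_erase hq1 p
  have e9 := hA.symm p q
  rw [hA.self] at e7
  -- The centre `q` has degree at most k + 1 ≤ n - 3, and every vertex other than `p` and `q` has
  -- degree at most 2, which is below n - 2.
  by_cases huq : u = q
  · rw [huq] at hd
    linarith [hA.nonneg p q]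
  · have hu2 : u ∈ (S.erase p).erase q := mem_erase.2 ⟨huq, mem_erase.2 ⟨hup, hu⟩⟩
    have e10 : degIn A ((S.erase p).erase q) u = 0 := sum_eq_zero fun y hy => hz u hu2 y hy
    have e11 := hA.degIn_erase hp u
    have e12 := hA.degIn_erase hq1 u
    linarith [hA.le_one u p, hA.le_one u q]

/-- Equality in the bound obtained from deleting a vertex with exactly one non-neighbour. -/
theorem exists_doubleStar_of_quadSum_eq_zero {S : Finset V} {u : V} {n : ℤ} (hn : #S = n)
    (hn3 : 3 ≤ n) (hm : degSum A S = 4 * (n - 2)) (hu : u ∈ S) (hd : degIn A S u = n - 2)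
    (hpos : ∀ x ∈ S, 1 ≤ degIn A S x) (hB : quadSum S (matchParity A) ≤ 0) :
    ∃ q ∈ S, u ≠ q ∧ (∀ x ∈ S, x ≠ u → x ≠ q → A u x = 1) ∧
      ∀ x ∈ S, ∀ y ∈ S, x ≠ u → y ≠ u → A x y = 1 → x = q ∨ y = q := by
  have hcount := hA.quadSum_erase_le hu rfl rfl
  change quadSum (S.erase u) (matchParity A) + 12 * (degIn A S u * degSum A (nonNbrs A S u) +
      2 * ∑ z ∈ nonNbrs A S u, degIn A (nbrs A S u) z * (degIn A S u - degIn A (nbrs A S u) z)) ≤ _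
    at hcount
  have hcard := hA.card_eq_nbrs_add hu
  have hsum := hA.degSum_eq_nbrs_add hu
  have hN := hA.degIn_eq_card_nbrs hu
  have h0 := quadSum_nonneg hA.matchParity_nonneg (S.erase u)
  obtain ⟨q, hR⟩ : ∃ q, nonNbrs A S u = {q} := card_eq_one.1 (by omega)
  have hqR : q ∈ nonNbrs A S u := by simp [hR]
  have hqS : q ∈ S.erase u := (mem_filter.1 hqR).1
  have hq1 := hA.degIn_of_mem_nonNbrs hu hqR
  have hq2 := hpos q (mem_of_mem_erase hqS)
  have hle := hA.degIn_le_card (nbrs A S u) q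
  have hR0 : degSum A {q} = 0 := by simp [degSum, degIn, hA.self]
  have hR1 : degIn A {q} q = 0 := by simp [degIn, hA.self]
  rw [hR, sum_singleton, hR0] at hsum hcount
  rw [hR, hR1] at hq1
  rw [← hN] at hle
  -- With t the number of neighbours of `q` in `N` and d = deg u, the count forces t(d - t) ≤ 0, and
  -- t ≥ 1. The edge count then leaves no edge within `N`.
  have hq3 : degIn A (nbrs A S u) q = degIn A S u := by nlinarith
  have hN0 : degSum A (nbrs A S u) = 0 := by linarith
  have hmem : ∀ x ∈ S, x ≠ u → x ≠ q → x ∈ nbrs A S u := by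
    intro x hx hxu hxq
    have : x ∈ S.erase u := mem_erase.2 ⟨hxu, hx⟩
    rw [hA.erase_eq_nbrs_union, hR, mem_union, mem_singleton] at this
    exact this.resolve_right hxq
  refine ⟨q, mem_of_mem_erase hqS, (ne_of_mem_erase hqS).symm,
    fun x hx hxu hxq => (mem_filter.1 (hmem x hx hxu hxq)).2, fun x hx y hy hxu hyu hxy => ?_⟩
  by_contra! h
  have := hA.eq_zero_of_degSum_eq_zero hN0 (hmem x hx hxu h.1) (hmem y hy hyu h.2)
  omega

/-- At least k + 1 edges avoid `u`, which carries (k+1)(n-4-k) exactly to (k+1)(n-3-k) and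
overshoots in the other alternative. Equality therefore needs deg u = n - 2, and this identifies `u`
with the centre `p` of the smaller double star, so the leaf can be put back. -/
theorem quadBound_of_pendant {S : Finset V} {u v : V} {n k : ℤ} (hn : #S = n)
    (hm : degSum A S = 2 * (k + n - 1)) (hk1 : 1 ≤ k) (hv : v ∈ S)
    (hu : u ∈ S) (hvu : A v u = 1) (hd : degIn A S v = 1) (hdu : degIn A S u ≤ n - 2)
    (hS' : HasNoSmallComponent A (S.erase v)) (ih : QuadBound A (S.erase v) (n - 1) k) :
    QuadBound A S n k := by
  have hb := hA.quadSum_pendant_le hv hu hvu hd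
  have hc := card_erase_add_one hv
  have hs := hA.degSum_erase hv
  have hu1 : u ∈ S.erase v := mem_erase.2 ⟨(hA.ne_of_eq_one hvu).symm, hu⟩
  have hdu' := hA.degIn_erase hv u
  rw [hA.symm v u, hvu] at hdu'
  have h0 := quadSum_nonneg hA.matchParity_nonneg (S.erase v)
  refine ⟨?_, fun _ hk h1 h2 => ?_⟩
  · rcases ih.1 with h | h
    · left; linarith
    · right; linarith
  · rcases ih.1 with h | h
    · linarith
    · have hdeg : degIn A S u = n - 2 := by
        refine le_antisymm hdu ?_
        by_contra! h3
        have : degIn A S u ≤ n - 3 := by omega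
        linarith
      by_cases hk5 : k ≤ n - 1 - 4
      · obtain ⟨p, hp, q, hq, hpq, hdom, hcov⟩ := ih.2 hk1 hk5 (by linarith) (by linarith)
        have hup := hA.eq_of_doubleStar (n := n - 1) (by omega) (by linarith) hk1 hk5 hp hq hpq
          hdom hcov hu1 (by linarith)
        rw [hup] at hvu
        exact hA.isDoubleStar_of_erase_pendant hp hq hpq hvu hd hdom hcov
      -- Here k is out of range for the equality clause of the smaller graph, whose bound is 0; the
      -- double star is obtained directly.
      · obtain rfl : n = k + 4 := by omega
        obtain ⟨q, hq, huq, hdom, hcov⟩ := hA.exists_doubleStar_of_quadSum_eq_zero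
          (n := k + 3) (by omega) (by linarith) (by linarith) hu1 (by linarith)
          (fun x hx => (hS' x hx).1) (by linarith)
        exact hA.isDoubleStar_of_erase_pendant hu1 hq huq hvu hd hdom hcov

/-- Outside 1 ≤ k ≤ n - 4 one of the two products is not positive. Inside that range either a vertex
dominates, or some vertex has degree 1, 2 or 3 and can be deleted, with its whole component if that
is a path or a triangle on three vertices. -/
theorem quadBound (S : Finset V) : ∀ n k : ℤ, #S = n → degSum A S = 2 * (k + n - 1) →
    HasNoSmallComponent A S → QuadBound A S n k := by
  induction S using Finset.strongInduction with
  | H S ih =>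
  intro n k hn hm hS
  have hlow := hA.card_mul_le_degSum fun x hx => (hS x hx).1
  have hb0 := quadSum_nonneg hA.matchParity_nonneg S
  by_cases hk1 : 1 ≤ k
  swap
  · refine ⟨.inl (le_trans ?_ hb0), fun h => absurd h hk1⟩
    nlinarith
  by_cases hk : k ≤ n - 4
  swap
  · refine ⟨.inr (le_trans ?_ hb0), fun _ h => absurd h hk⟩
    nlinarith
  by_cases hdom : ∃ u ∈ S, degIn A S u = n - 1
  · obtain ⟨u, hu, hdu⟩ := hdom
    have hcard := hA.card_eq_nbrs_add hu
    rw [← hA.degIn_eq_card_nbrs hu] at hcard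
    have hR : nonNbrs A S u = ∅ := card_eq_zero.1 (by omega)
    have := hA.le_quadSum_of_dominating hu (fun x hx hxu => by
      have h1 : x ∈ S.erase u := mem_erase.2 ⟨hxu, hx⟩
      rw [hA.erase_eq_nbrs_union, hR, union_empty] at h1
      exact (mem_filter.1 h1).2) hn hm
    exact ⟨.inl this.1, fun h _ h1 _ => this.2 h h1⟩
  push Not at hdom
  have hmax : ∀ u ∈ S, degIn A S u ≤ n - 2 := fun u hu => by
    have := hA.degIn_le_card_sub_one hu
    have := hdom u hu
    omega
  have hexists : ∀ v ∈ S, ∃ u ∈ S, A v u = 1 := by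
    intro v hv
    by_contra! h
    have h1 : degIn A S v = 0 :=
      sum_eq_zero fun x hx => (hA.zero_or_one v x).resolve_right (h x hx)
    have := (hS v hv).1
    omega
  have hcardE : ∀ v ∈ S, (#(S.erase v) : ℤ) = n - 1 := fun v hv => by
    have := card_erase_add_one hv
    omega
  by_cases hone : ∃ v ∈ S, degIn A S v = 1
  · obtain ⟨v, hv, hd⟩ := hone
    obtain ⟨u, hu, hvu⟩ := hexists v hv
    have huv : A u v = 1 := by rw [hA.symm, hvu]
    have hs := hA.degSum_erase hv
    have hdu := (hS v hv).2 u hu hvu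
    by_cases hpath : ∃ w ∈ S, w ≠ v ∧ A u w = 1 ∧ degIn A S u = 2 ∧ degIn A S w = 1
    · obtain ⟨w, hw, hwv, huw, hdu2, hdw⟩ := hpath
      refine hA.quadBound_of_path_component hn hm hk1 hk hS hu hv hw hwv.symm huv huw hdu2 hd hdw
        fun hT hsT hcT => ih _ ?_ _ _ hcT (by linarith) hT
      exact ((erase_subset _ _).trans (erase_subset _ _)).trans_ssubset (erase_ssubset hv)
    · push Not at hpath
      have hS' : HasNoSmallComponent A (S.erase v) := by
        refine hA.hasNoSmallComponent_erase hS hv fun u' hu' hu'v => ?_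
        obtain rfl : u' = u := hA.eq_of_degIn_le_one hu' hu (by rw [hA.symm, hu'v]) hvu hd.le
        refine ⟨by linarith, fun x hx hxv hux => ?_⟩
        have hx0 : A x v = 0 := (hA.zero_or_one x v).resolve_right fun h =>
          hA.ne_of_eq_one hux (hA.eq_of_degIn_le_one hu hx hvu (by rw [hA.symm, h]) hd.le)
        have h1 := hpath x hx hxv hux
        have h2 := (hS x hx).1
        omega
      exact hA.quadBound_of_pendant hn hm hk1 hv hu hvu hd (hmax u hu) hS'
        (ih _ (erase_ssubset hv) _ _ (hcardE v hv) (by linarith) hS')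
  have hmin2 : ∀ x ∈ S, 2 ≤ degIn A S x := fun x hx => by
    push Not at hone
    have := (hS x hx).1
    have := hone x hx
    omega
  by_cases htwo : ∃ v ∈ S, degIn A S v = 2
  · obtain ⟨v, hv, hd⟩ := htwo
    have hs := hA.degSum_erase hv
    by_cases htri : ∃ u ∈ S, ∃ w ∈ S, A u v = 1 ∧ A u w = 1 ∧ A w v = 1 ∧ degIn A S u = 2 ∧
        degIn A S w = 2
    · obtain ⟨u, hu, w, hw, huv, huw, hwv, hdu, hdw⟩ := htri
      refine hA.quadBound_of_triangle_component hn hm hk1 hk hS hu hv hw huv huw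
        (by rw [hA.symm, hwv]) hdu hd hdw fun hT hsT hcT => ih _ ?_ _ _ hcT (by linarith) hT
      exact ((erase_subset _ _).trans (erase_subset _ _)).trans_ssubset (erase_ssubset hv)
    · push Not at htri
      have hS' : HasNoSmallComponent A (S.erase v) := by
        refine hA.hasNoSmallComponent_erase hS hv fun u hu huv =>
          ⟨hmin2 u hu, fun x hx hxv hux => ?_⟩
        have h1 := hmin2 u hu
        have h2 := hmin2 x hx
        rcases hA.zero_or_one x v with h | h
        · linarith
        · have := htri u hu x hx huv hux h
          omega
      exact hA.quadBound_of_degIn_two hn hm hk hmin2 hv hd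
        (ih _ (erase_ssubset hv) _ _ (hcardE v hv) (by linarith) hS')
  have hmin3 : ∀ x ∈ S, 3 ≤ degIn A S x := fun x hx => by
    push Not at htwo
    have := hmin2 x hx
    have := htwo x hx
    omega
  -- Minimum degree 4 would give at least 2n edges, against k + n - 1 ≤ 2n - 5.
  obtain ⟨v, hv, hd⟩ : ∃ v ∈ S, degIn A S v = 3 := by
    by_contra! h
    have := hA.card_mul_le_degSum (S := S) (c := 4) fun x hx => by
      have := hmin3 x hx
      have := h x hx
      omega
    linarith
  have hs := hA.degSum_erase hv
  refine hA.quadBound_of_degIn_three hn hm hk hmin3 hv hd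
    (ih _ (erase_ssubset hv) _ _ (hcardE v hv) (by linarith) ?_)
  refine hA.hasNoSmallComponent_erase hS hv fun u hu huv =>
    ⟨hmin2 u hu, fun x hx hxv hux => ?_⟩
  have h1 := hmin3 u hu
  have h2 := hmin3 x hx
  have h3 := hA.le_one x v
  linarith

end IsAdjFun

/-! ### Squared Pfaffians of four vertices compared with matching parity. -/

/-- The Pfaffian of the principal submatrix on four indices. -/
def pfaffian₄ {V : Type*} (s : V → V → ℤ) (a b c d : V) : ℤ :=
  s a b * s c d - s a c * s b d + s a d * s b c

section

variable {V : Type*} {s : V → V → ℤ}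

theorem isAlternatingSymm_pfaffian₄_sq (hs : ∀ u v, s v u = -s u v) :
    IsAlternatingSymm fun a b c d => pfaffian₄ s a b c d ^ 2 where
  swap₁ a b c d := by
    simp only [pfaffian₄]
    rw [hs a b]
    ring
  swap₂ a b c d := by
    simp only [pfaffian₄]
    rw [hs b c]
    ring
  swap₃ a b c d := by
    simp only [pfaffian₄]
    rw [hs c d]
    ring
  self a c d := by
    have h : s a a = 0 := by linarith [hs a a]
    simp only [pfaffian₄, h]
    ring

/-- Expanding the square, the cross terms are even and the square terms are those of the matching
count. A nonnegative integer is at least its residue modulo 2. -/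
theorem matchParity_sq_le (s : V → V → ℤ) (a b c d : V) :
    matchParity (fun u v => s u v ^ 2) a b c d ≤ pfaffian₄ s a b c d ^ 2 := by
  have h1 : pfaffian₄ s a b c d ^ 2 =
      (s a b ^ 2 * s c d ^ 2 + s a c ^ 2 * s b d ^ 2 + s a d ^ 2 * s b c ^ 2) +
      2 * (-(s a b * s c d * (s a c * s b d)) + s a b * s c d * (s a d * s b c)
        - s a c * s b d * (s a d * s b c)) := by
    simp only [pfaffian₄]
    ring
  have h2 : matchParity (fun u v => s u v ^ 2) a b c d = pfaffian₄ s a b c d ^ 2 % 2 := by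
    rw [h1, matchParity]
    omega
  have h3 := sq_nonneg (pfaffian₄ s a b c d)
  rw [h2]
  omega

theorem isAdjFun_sq (hs : ∀ u v, s v u = -s u v) (h01 : ∀ u v, s u v = 0 ∨ s u v ^ 2 = 1) :
    IsAdjFun fun u v => s u v ^ 2 where
  zero_or_one u v := by
    rcases h01 u v with h | h
    · left; simp [h]
    · right; exact h
  symm u v := by simp only [hs u v, neg_sq]
  self u := by
    have h : s u u = 0 := by linarith [hs u u]
    simp [h]

variable [Fintype V]

/-- Each of the three square terms sums to (Σ s²)²; each of the three cross terms is, up to sign, a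
closed walk of length four, and so sums to ± the trace of the fourth power. -/
theorem quadSum_pfaffian₄_sq (hs : ∀ u v, s v u = -s u v) :
    quadSum univ (fun a b c d => pfaffian₄ s a b c d ^ 2) =
      3 * (∑ u, ∑ v, s u v ^ 2) ^ 2 - 6 * ∑ u, ∑ v, (∑ w, s u w * s w v) ^ 2 := by
  have q1 : ∑ a, ∑ b, ∑ c, ∑ d, (s a b * s c d) ^ 2 = (∑ u, ∑ v, s u v ^ 2) ^ 2 := by
    simp only [mul_pow, ← mul_sum, ← sum_mul]
    ring
  have q2 : ∑ a, ∑ b, ∑ c, ∑ d, (s a c * s b d) ^ 2 = (∑ u, ∑ v, s u v ^ 2) ^ 2 := by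
    rw [← q1]
    exact sum_congr rfl fun a _ => sum_comm
  have q3 : ∑ a, ∑ b, ∑ c, ∑ d, (s a d * s b c) ^ 2 = (∑ u, ∑ v, s u v ^ 2) ^ 2 := by
    rw [← q2]
    exact sum_congr rfl fun a _ => sum_congr rfl fun b _ => sum_comm
  have p1 : ∑ a, ∑ b, ∑ c, ∑ d, s a b * s c d * (s a c * s b d) =
      ∑ u, ∑ v, (∑ w, s u w * s w v) ^ 2 := by
    refine sum_congr rfl fun a _ => ?_
    rw [sum_congr rfl fun b _ => sum_comm, sum_comm]
    refine sum_congr rfl fun d _ => ?_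
    rw [sq, sum_mul_sum]
    exact sum_congr rfl fun b _ => sum_congr rfl fun c _ => by ring
  have p2 : ∑ a, ∑ b, ∑ c, ∑ d, s a b * s c d * (s a d * s b c) =
      -∑ u, ∑ v, (∑ w, s u w * s w v) ^ 2 := by
    rw [← p1, ← sum_neg_distrib]
    refine sum_congr rfl fun a _ => ?_
    rw [← sum_neg_distrib]
    refine sum_congr rfl fun b _ => ?_
    rw [← sum_neg_distrib, sum_comm]
    refine sum_congr rfl fun c _ => ?_
    rw [← sum_neg_distrib]
    refine sum_congr rfl fun d _ => ?_
    rw [hs c d]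
    ring
  have p3 : ∑ a, ∑ b, ∑ c, ∑ d, s a c * s b d * (s a d * s b c) =
      ∑ u, ∑ v, (∑ w, s u w * s w v) ^ 2 := by
    refine sum_congr rfl fun a _ => sum_congr rfl fun b _ => ?_
    rw [sq, sum_mul_sum]
    refine sum_congr rfl fun c _ => sum_congr rfl fun d _ => ?_
    rw [hs c b, hs d b]
    ring
  have key : ∀ a b c d, pfaffian₄ s a b c d ^ 2 = (s a b * s c d) ^ 2 + (s a c * s b d) ^ 2 +
      (s a d * s b c) ^ 2 - 2 * (s a b * s c d * (s a c * s b d)) +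
      2 * (s a b * s c d * (s a d * s b c)) - 2 * (s a c * s b d * (s a d * s b c)) := by
    intro a b c d
    simp only [pfaffian₄]
    ring
  have key' : quadSum univ (fun a b c d => pfaffian₄ s a b c d ^ 2) =
      ∑ a, ∑ b, ∑ c, ∑ d, (s a b * s c d) ^ 2 + ∑ a, ∑ b, ∑ c, ∑ d, (s a c * s b d) ^ 2 +
      ∑ a, ∑ b, ∑ c, ∑ d, (s a d * s b c) ^ 2 -
      2 * ∑ a, ∑ b, ∑ c, ∑ d, s a b * s c d * (s a c * s b d) +
      2 * ∑ a, ∑ b, ∑ c, ∑ d, s a b * s c d * (s a d * s b c) -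
      2 * ∑ a, ∑ b, ∑ c, ∑ d, s a c * s b d * (s a d * s b c) := by
    simp only [quadSum, tripleSum, key, sum_add_distrib, sum_sub_distrib]
    simp only [mul_sum]
  rw [key', q1, q2, q3, p1, p2, p3]
  ring

/-- The comparison holds termwise, so it is an equality everywhere once the sums agree. -/
theorem matchParity_eq_pfaffian₄_sq_of_quadSum_le
    (h : quadSum univ (fun a b c d => pfaffian₄ s a b c d ^ 2) ≤
      quadSum univ (matchParity fun u v => s u v ^ 2)) (a b c d : V) :
    matchParity (fun u v => s u v ^ 2) a b c d = pfaffian₄ s a b c d ^ 2 := by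
  have h0 := matchParity_sq_le s
  have l3 := fun a b c => sum_le_sum fun d (_ : d ∈ univ) => h0 a b c d
  have l2 := fun a b => sum_le_sum fun c (_ : c ∈ univ) => l3 a b c
  have l1 := fun a => sum_le_sum fun b (_ : b ∈ univ) => l2 a b
  have l0 := sum_le_sum fun a (_ : a ∈ univ) => l1 a
  have e0 := (sum_eq_sum_iff_of_le fun a (_ : a ∈ univ) => l1 a).1 (le_antisymm l0 h) a (mem_univ a)
  have e1 := (sum_eq_sum_iff_of_le fun b (_ : b ∈ univ) => l2 a b).1 e0 b (mem_univ b)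
  have e2 := (sum_eq_sum_iff_of_le fun c (_ : c ∈ univ) => l3 a b c).1 e1 c (mem_univ c)
  exact (sum_eq_sum_iff_of_le fun d (_ : d ∈ univ) => h0 a b c d).1 e2 d (mem_univ d)

theorem quadSum_matchParity_le (s : V → V → ℤ) :
    quadSum univ (matchParity fun u v => s u v ^ 2) ≤
      quadSum univ (fun a b c d => pfaffian₄ s a b c d ^ 2) :=
  sum_le_sum fun a _ => sum_le_sum fun b _ => sum_le_sum fun c _ => sum_le_sum fun d _ =>
    matchParity_sq_le s a b c d

end

/-! ### The energy bound for oriented graphs. -/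

namespace OrientedGraph

open Classical in
/-- The entries of the skew-adjacency matrix, as integers. -/
noncomputable def sgn {V : Type*} (G : OrientedGraph V) (u v : V) : ℤ :=
  if G.Adj u v then 1 else if G.Adj v u then -1 else 0

section

variable {V : Type*} (G : OrientedGraph V)

theorem skewAdjMatrix_apply (u v : V) : G.skewAdjMatrix u v = G.sgn u v := by
  simp only [skewAdjMatrix, sgn, Matrix.of_apply]
  split_ifs <;> simp

theorem sgn_swap (u v : V) : G.sgn v u = -G.sgn u v := by
  have h := G.asymm u v
  simp only [sgn]
  split_ifs <;> simp_all

theorem sgn_zero_or_sq (u v : V) : G.sgn u v = 0 ∨ G.sgn u v ^ 2 = 1 := by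
  simp only [sgn]
  split_ifs <;> simp

theorem isAdjFun : IsAdjFun fun u v => G.sgn u v ^ 2 :=
  isAdjFun_sq G.sgn_swap G.sgn_zero_or_sq

theorem adj_iff (u v : V) : G.Adj u v ↔ G.sgn u v = 1 := by
  simp only [sgn]
  split_ifs <;> simp_all

theorem underlying_adj_iff (u v : V) : G.underlying.Adj u v ↔ G.sgn u v ^ 2 = 1 := by
  have h := G.asymm u u
  have : G.underlying.Adj u v ↔ u ≠ v ∧ (G.Adj u v ∨ G.Adj v u) := Iff.rfl
  rw [this]
  simp only [sgn]
  constructor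
  · rintro ⟨-, h1 | h1⟩
    · simp [h1]
    · split_ifs <;> simp
  · intro h1
    refine ⟨?_, ?_⟩
    · rintro rfl
      simp_all
    · by_contra! h2
      simp [h2.1, h2.2] at h1

theorem degSum_eq [Fintype V] : degSum (fun u v => G.sgn u v ^ 2) univ = 2 * G.numArcs := by
  classical
  have h1 : (G.numArcs : ℤ) = ∑ u, ∑ v, if G.Adj u v then 1 else 0 := by
    rw [numArcs, Set.ncard_eq_toFinset_card', ← Fintype.sum_prod_type'
      (f := fun u v => if G.Adj u v then (1 : ℤ) else 0), ← Finset.sum_filter]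
    simp only [sum_const, nsmul_eq_mul, mul_one]
    congr 2
    ext
    simp
  have h2 : ∑ u, ∑ v, (if G.Adj v u then (1 : ℤ) else 0) = G.numArcs := by
    rw [h1, sum_comm]
  rw [two_mul]
  nth_rw 1 [h1]
  rw [← h2]
  simp only [degSum, degIn, ← sum_add_distrib]
  refine sum_congr rfl fun u _ => sum_congr rfl fun v _ => ?_
  have h := G.asymm u v
  simp only [sgn]
  split_ifs <;> simp_all

/-- The sum of the squared Pfaffians over all ordered quadruples, that is, `24` times the
coefficient of the characteristic polynomial of index four. -/
noncomputable def pfSum [Fintype V] : ℤ := quadSum univ fun a b c d => pfaffian₄ G.sgn a b c d ^ 2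

theorem pfSum_nonneg [Fintype V] [DecidableEq V] : 0 ≤ G.pfSum :=
  quadSum_nonneg (fun _ _ _ _ => sq_nonneg _) _

/-- Both traces are read off from `sgn`: the first is 2m, and `quadSum_pfaffian₄_sq` turns the
second into 2(m² - 2b) with b = `pfSum`/24, as each 4-set is counted in 24 orders. -/
theorem skewEnergy_bound [Fintype V] [DecidableEq V] :
    2 * √(G.numArcs + 2 * √((G.pfSum : ℝ) / 24)) ≤ G.skewEnergy ∧
      (G.skewAdjMatrix.rank ≤ 4 →
        G.skewEnergy = 2 * √(G.numArcs + 2 * √((G.pfSum : ℝ) / 24))) := by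
  have h1 : ∑ u, ∑ v, G.sgn u v ^ 2 = 2 * G.numArcs := G.degSum_eq
  have h2 := quadSum_pfaffian₄_sq G.sgn_swap
  rw [h1] at h2
  have h1' : ∑ u, ∑ v, (G.sgn u v : ℝ) ^ 2 = 2 * G.numArcs := by exact_mod_cast h1
  have h2' : (G.pfSum : ℝ) =
      3 * (2 * G.numArcs) ^ 2 - 6 * ∑ u, ∑ v, (∑ w, (G.sgn u w : ℝ) * G.sgn w v) ^ 2 := by
    rw [pfSum, h2]
    push_cast
    rfl
  refine G.two_mul_sqrt_le_skewEnergy ?_ ?_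
  · rw [G.transpose_skewAdjMatrix, ← h1']
    simp only [Matrix.trace, Matrix.diag, Matrix.mul_apply, Matrix.neg_apply, skewAdjMatrix_apply]
    refine sum_congr rfl fun u _ => sum_congr rfl fun v _ => ?_
    rw [G.sgn_swap u v]
    push_cast
    ring
  · have h3 : ∑ u, ∑ v, (∑ w, (G.sgn u w : ℝ) * G.sgn w v) ^ 2 =
        2 * ((G.numArcs : ℝ) ^ 2 - 2 * ((G.pfSum : ℝ) / 24)) := by linarith
    rw [← h3, G.transpose_skewAdjMatrix, neg_mul, neg_mul_neg]
    simp only [Matrix.trace, Matrix.diag]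
    refine sum_congr rfl fun u _ => ?_
    rw [Matrix.mul_apply]
    refine sum_congr rfl fun v _ => ?_
    simp only [Matrix.mul_apply, skewAdjMatrix_apply]
    rw [sq]
    congr 1
    refine sum_congr rfl fun w _ => ?_
    rw [G.sgn_swap u w, G.sgn_swap w v]
    push_cast
    ring

/-- A nonempty vertex set closed under adjacency is everything, so an isolated vertex or edge would
be the whole graph. -/
theorem hasNoSmallComponent [Fintype V] [DecidableEq V] (hG : G.Connected)
    (hV : 3 ≤ Fintype.card V) : HasNoSmallComponent (fun u v => G.sgn u v ^ 2) univ := by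
  have hA := G.isAdjFun
  have hclosed : ∀ T : Finset V, T.Nonempty → (∀ x ∈ T, ∀ y, G.sgn x y ^ 2 = 1 → y ∈ T) →
      T = univ := by
    rintro T ⟨x, hx⟩ hT
    rw [eq_univ_iff_forall]
    intro y
    obtain ⟨w⟩ := hG.preconnected x y
    induction w with
    | nil => exact hx
    | cons h _ ih => exact ih (hT _ hx _ ((G.underlying_adj_iff _ _).1 h))
  have hpos : ∀ u, 1 ≤ degIn (fun u v => G.sgn u v ^ 2) univ u := by
    intro u
    by_contra! h
    have h0 : degIn (fun u v => G.sgn u v ^ 2) univ u = 0 :=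
      le_antisymm (by omega) (hA.degIn_nonneg _ _)
    have h1 := (sum_eq_zero_iff_of_nonneg fun v _ => hA.nonneg u v).1 h0
    have h2 := hclosed {u} (singleton_nonempty u) (by
      intro x hx y hxy
      rw [mem_singleton.1 hx] at hxy
      have := h1 y (mem_univ y)
      omega)
    rw [← card_univ, ← h2, card_singleton] at hV
    omega
  intro u _
  refine ⟨hpos u, fun v _ huv => ?_⟩
  by_contra! h
  have hvu : G.sgn v u ^ 2 = 1 := (hA.symm u v).trans huv
  have hu := hpos u
  have hv := hpos v
  have h2 := hclosed {u, v} (insert_nonempty _ _) (by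
    intro x hx y hxy
    rw [mem_insert, mem_singleton] at hx ⊢
    rcases hx with rfl | rfl
    · exact .inr (hA.eq_of_degIn_le_one (mem_univ _) (mem_univ _) hxy huv (by omega))
    · exact .inl (hA.eq_of_degIn_le_one (mem_univ _) (mem_univ _) hxy hvu (by omega)))
  rw [← card_univ, ← h2] at hV
  have := card_le_two (a := u) (b := v)
  omega

end

end OrientedGraph

/-! ### Standard orientations of double stars: rank, coefficient, isomorphism. -/

theorem exists_equiv_of_card_fiber_eq {V W γ : Type*} [Fintype V] [Fintype W] [DecidableEq γ]
    {f : V → γ} {g : W → γ} (h : ∀ y, #(univ.filter (f · = y)) = #(univ.filter (g · = y))) :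
    ∃ e : V ≃ W, ∀ x, g (e x) = f x := by
  have h' : ∀ y, Nonempty ({x // f x = y} ≃ {x // g x = y}) := fun y => by
    rw [← Fintype.card_eq, Fintype.card_subtype, Fintype.card_subtype, h]
  have E := fun y => (h' y).some
  refine ⟨(Equiv.sigmaFiberEquiv f).symm.trans
    ((Equiv.sigmaCongrRight E).trans (Equiv.sigmaFiberEquiv g)), fun x => ?_⟩
  exact (E (f x) ⟨x, rfl⟩).2

theorem Matrix.rank_add_le {V : Type*} [Fintype V] (M N : Matrix V V ℝ) :
    (M + N).rank ≤ M.rank + N.rank := by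
  rw [Matrix.rank, Matrix.mulVecLin_add]
  exact (Submodule.finrank_mono (LinearMap.range_add_le _ _)).trans
    (Submodule.finrank_add_le_finrank_add_finrank _ _)

namespace OrientedGraph

theorem sgn_self {V : Type*} (G : OrientedGraph V) (x : V) : G.sgn x x = 0 := by
  linarith [G.sgn_swap x x]

/-- Every arc meets `p` or `q`; all vertices except possibly `q` are out-neighbours of `p`, and all
arcs between `q` and vertices other than `p` end in `q`. -/
structure IsStandard {V : Type*} (G : OrientedGraph V) (p q : V) : Prop where
  ne : p ≠ q
  sgn_centers : G.sgn p q = 0 ∨ G.sgn p q = 1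
  sgn_left : ∀ x, x ≠ p → x ≠ q → G.sgn p x = 1
  sgn_right : ∀ x, x ≠ p → x ≠ q → G.sgn q x = 0 ∨ G.sgn q x = -1
  sgn_other : ∀ x y, x ≠ p → x ≠ q → y ≠ p → y ≠ q → G.sgn x y = 0

/-- The number of arcs from vertices other than `p` to `q`. -/
noncomputable def inArcs {V : Type*} [Fintype V] [DecidableEq V] (G : OrientedGraph V) (p q : V) : ℕ :=
  #(((univ.erase p).erase q).filter (G.sgn q · = -1))

/-- All nonzero entries lie in two rows and two columns. With `D` the coordinate projection onto `p`
and `q`, the matrix is a sum of two products each having the rank-two factor `D`. -/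
theorem rank_skewAdjMatrix_le_four {V : Type*} [Fintype V] [DecidableEq V] (G : OrientedGraph V)
    {p q : V} (h : ∀ x y, x ≠ p → x ≠ q → y ≠ p → y ≠ q → G.sgn x y = 0) :
    G.skewAdjMatrix.rank ≤ 4 := by
  set D : Matrix V V ℝ := Matrix.diagonal fun x => if x = p ∨ x = q then 1 else 0
  set S := G.skewAdjMatrix
  have hS : S = D * S + (1 - D) * S * D := by
    have : D * S + (1 - D) * S * D = S - (1 - D) * S * (1 - D) := by noncomm_ring
    rw [this, eq_comm, sub_eq_self]
    have h1 : (1 - D) = Matrix.diagonal fun x => if x = p ∨ x = q then (0 : ℝ) else 1 := by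
      rw [← Matrix.diagonal_one, Matrix.diagonal_sub]
      congr 1
      ext x
      split_ifs <;> simp
    rw [h1]
    ext x y
    rw [Matrix.mul_diagonal, Matrix.diagonal_mul, Matrix.zero_apply,
      show S x y = G.sgn x y from G.skewAdjMatrix_apply x y]
    by_cases hx : x = p ∨ x = q
    · simp [hx]
    · by_cases hy : y = p ∨ y = q
      · simp [hy]
      · push Not at hx hy
        simp [h x y hx.1 hx.2 hy.1 hy.2]
  have hD : D.rank ≤ 2 := by
    rw [Matrix.rank_diagonal, Fintype.card_subtype]
    refine (card_le_card (t := {p, q}) fun x hx => ?_).trans card_le_two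
    simpa [or_iff_not_imp_left] using hx
  have h2 := Matrix.rank_add_le (D * S) ((1 - D) * S * D)
  rw [← hS] at h2
  have h3 := Matrix.rank_mul_le_left D S
  have h4 := Matrix.rank_mul_le_right ((1 - D) * S) D
  omega

namespace IsStandard

variable {V W : Type*} {G : OrientedGraph V} {p q : V}

theorem sum_sgn [Fintype V] [DecidableEq V] (h : G.IsStandard p q) :
    ∑ x ∈ (univ.erase p).erase q, G.sgn q x = -G.inArcs p q := by
  rw [inArcs, card_filter]
  push_cast
  rw [← sum_neg_distrib]
  refine sum_congr rfl fun x hx => ?_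
  simp only [mem_erase] at hx
  rcases h.sgn_right x hx.2.1 hx.1 with h | h <;> simp [h]

theorem sgn_sq (h : G.IsStandard p q) {x : V} (hp : x ≠ p) (hq : x ≠ q) :
    G.sgn q x ^ 2 = -G.sgn q x := by
  rcases h.sgn_right x hp hq with h | h <;> simp [h]

theorem card_rest [Fintype V] [DecidableEq V] (h : G.IsStandard p q) :
    (#((univ.erase p).erase q) : ℤ) = Fintype.card V - 2 := by
  have h1 := card_erase_add_one (mem_univ p)
  have h2 := card_erase_add_one (mem_erase.2 ⟨h.ne.symm, mem_univ q⟩)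
  rw [card_univ] at h1
  omega

theorem numArcs_eq [Fintype V] [DecidableEq V] (h : G.IsStandard p q) :
    (G.numArcs : ℤ) = Fintype.card V - 2 + G.sgn p q + G.inArcs p q := by
  have hA := G.isAdjFun
  have hq := mem_erase.2 ⟨h.ne.symm, mem_univ q⟩
  have h1 := hA.degSum_erase (mem_univ p)
  have h2 := hA.degSum_erase hq
  have h3 := hA.degIn_erase (mem_univ p) p
  have h4 := hA.degIn_erase hq p
  have h5 := hA.degIn_erase hq q
  have h6 : degIn (fun u v => G.sgn u v ^ 2) ((univ.erase p).erase q) p = Fintype.card V - 2 := by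
    rw [← h.card_rest, degIn, sum_congr rfl (g := fun _ => 1)]
    · simp
    · intro x hx
      simp only [mem_erase] at hx
      simp [h.sgn_left x hx.2.1 hx.1]
  have h7 : degIn (fun u v => G.sgn u v ^ 2) ((univ.erase p).erase q) q = G.inArcs p q := by
    rw [← neg_neg (G.inArcs p q : ℤ), ← h.sum_sgn, degIn, ← sum_neg_distrib]
    refine sum_congr rfl fun x hx => ?_
    simp only [mem_erase] at hx
    exact h.sgn_sq hx.2.1 hx.1
  have h8 : degSum (fun u v => G.sgn u v ^ 2) ((univ.erase p).erase q) = 0 := by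
    refine sum_eq_zero fun x hx => sum_eq_zero fun y hy => ?_
    simp only [mem_erase] at hx hy
    simp [h.sgn_other x y hx.2.1 hx.1 hy.2.1 hy.1]
  have h9 : G.sgn p q ^ 2 = G.sgn p q := by
    rcases h.sgn_centers with h | h <;> simp [h]
  rw [G.degSum_eq] at h1
  rw [hA.self] at h3 h5
  linarith

/-- Pfaffians of quadruples missing `p` or `q` vanish. On `p, q, c, d` the Pfaffian is `sgn q c -
sgn q d`, nonzero exactly when one of `c`, `d` is joined to `q` and the other is not. -/
theorem pfSum_eq [Fintype V] [DecidableEq V] (h : G.IsStandard p q) :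
    G.pfSum = 24 * (G.inArcs p q * (Fintype.card V - 2 - G.inArcs p q)) := by
  have hf := isAlternatingSymm_pfaffian₄_sq G.sgn_swap
  set R := (univ.erase p).erase q with hR
  have hq : q ∈ univ.erase p := mem_erase.2 ⟨h.ne.symm, mem_univ q⟩
  have hz : ∀ x ∈ R, ∀ y ∈ R, G.sgn x y = 0 := by
    intro x hx y hy
    simp only [R, mem_erase] at hx hy
    exact h.sgn_other x y hx.2.1 hx.1 hy.2.1 hy.1
  have ht : ∀ v, tripleSum R (fun b c d => pfaffian₄ G.sgn v b c d ^ 2) = 0 := fun v =>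
    sum_eq_zero fun b hb => sum_eq_zero fun c hc => sum_eq_zero fun d hd => by
      simp [pfaffian₄, hz b hb c hc, hz b hb d hd, hz c hc d hd]
  have h1 : quadSum (univ.erase p) (fun a b c d => pfaffian₄ G.sgn a b c d ^ 2) = 0 := by
    rw [hf.quadSum_erase hq, ht, quadSum, sum_congr rfl fun a _ => ht a]
    simp
  have hdisj : Disjoint {q} R := by simp [R]
  have hu : univ.erase p = {q} ∪ R := by rw [hR, ← insert_eq, insert_erase hq]
  have h2 : ∑ c ∈ R, ∑ d ∈ R, pfaffian₄ G.sgn p q c d ^ 2 =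
      2 * (G.inArcs p q * (Fintype.card V - 2 - G.inArcs p q)) := by
    have h3 : ∀ c ∈ R, ∀ d ∈ R, pfaffian₄ G.sgn p q c d ^ 2 =
        -G.sgn q c - G.sgn q d - 2 * (G.sgn q c * G.sgn q d) := by
      intro c hc d hd
      rw [pfaffian₄, hz c hc d hd]
      simp only [R, mem_erase] at hc hd
      rw [h.sgn_left c hc.2.1 hc.1, h.sgn_left d hd.2.1 hd.1]
      linear_combination h.sgn_sq hc.2.1 hc.1 + h.sgn_sq hd.2.1 hd.1
    rw [sum_congr rfl fun c hc => sum_congr rfl fun d hd => h3 c hc d hd]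
    simp only [sum_sub_distrib, sum_neg_distrib, ← mul_sum, ← sum_mul, sum_const, nsmul_eq_mul]
    rw [h.sum_sgn, h.card_rest]
    ring
  rw [pfSum, hf.quadSum_erase (mem_univ p), h1, hu, tripleSum_union hdisj _
    (fun b c d => hf.swap₂ p b c d) (fun b c d => hf.swap₃ p b c d), ht]
  have h4 : ∀ d, pfaffian₄ G.sgn p q q d ^ 2 = 0 := fun d => by
    have h5 : G.sgn q q = 0 := by linarith [G.sgn_swap q q]
    simp only [pfaffian₄, h5]
    ring
  simp only [tripleSum, sum_singleton, h4, sum_const_zero, h2]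
  ring

theorem connected [Fintype V] [DecidableEq V] (h : G.IsStandard p q)
    (hpos : 0 < G.sgn p q + G.inArcs p q) : G.Connected := by
  have hp : ∀ x, x ≠ p → x ≠ q → G.underlying.Adj p x := fun x h1 h2 => by
    rw [underlying_adj_iff, h.sgn_left x h1 h2]
    rfl
  have hq : G.underlying.Reachable p q := by
    rcases h.sgn_centers with h0 | h0
    · obtain ⟨x, hx⟩ := card_pos.1 (by rw [h0] at hpos; simpa using hpos : 0 < G.inArcs p q)
      simp only [mem_filter, mem_erase] at hx
      refine (hp x hx.1.2.1 hx.1.1).reachable.trans (SimpleGraph.Adj.reachable ?_)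
      rw [underlying_adj_iff, G.sgn_swap, hx.2]
      rfl
    · refine SimpleGraph.Adj.reachable ?_
      rw [underlying_adj_iff, h0]
      rfl
  have hall : ∀ x, G.underlying.Reachable p x := by
    intro x
    by_cases h1 : x = p
    · rw [h1]
    · by_cases h2 : x = q
      · rwa [h2]
      · exact (hp x h1 h2).reachable
  have : Nonempty V := ⟨p⟩
  exact ⟨fun x y => (hall x).symm.trans (hall y)⟩

/-- The labels 2 and 3 single out `p` and `q`, since the other vertices carry 0 or -1. A bijection
preserving labels is then an isomorphism once the arcs between the centres agree. -/
theorem card_fiber [Fintype V] [DecidableEq V] (h : G.IsStandard p q) (y : ℤ) :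
    (#(univ.filter fun x => (if x = p then 2 else if x = q then 3 else G.sgn q x) = y) : ℤ) =
      (if y = 2 then 1 else 0) + (if y = 3 then 1 else 0) +
      (if y = 0 then (Fintype.card V : ℤ) - 2 - G.inArcs p q else 0) +
      (if y = -1 then (G.inArcs p q : ℤ) else 0) := by
  have hq : q ∈ univ.erase p := mem_erase.2 ⟨h.ne.symm, mem_univ q⟩
  rw [card_filter]
  push_cast
  rw [← add_sum_erase _ _ (mem_univ p), ← add_sum_erase _ _ hq, if_pos rfl, if_neg h.ne.symm,
    if_pos rfl]
  have h1 : ∑ x ∈ (univ.erase p).erase q,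
      (if (if x = p then 2 else if x = q then 3 else G.sgn q x) = y then (1 : ℤ) else 0) =
      ∑ x ∈ (univ.erase p).erase q, ((if y = 0 then 1 + G.sgn q x else 0) +
        (if y = -1 then -G.sgn q x else 0)) := by
    refine sum_congr rfl fun x hx => ?_
    simp only [mem_erase] at hx
    rw [if_neg hx.2.1, if_neg hx.1]
    rcases h.sgn_right x hx.2.1 hx.1 with h0 | h0 <;> rw [h0] <;> split_ifs <;> omega
  have h2 : ∑ x ∈ (univ.erase p).erase q, (1 + G.sgn q x) =
      (Fintype.card V : ℤ) - 2 - G.inArcs p q := by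
    rw [sum_add_distrib, h.sum_sgn, sum_const, nsmul_eq_mul, h.card_rest]
    ring
  have h3 : ∑ x ∈ (univ.erase p).erase q, -G.sgn q x = G.inArcs p q := by
    rw [sum_neg_distrib, h.sum_sgn, neg_neg]
  rw [h1, sum_add_distrib]
  have h4 : ∀ (P : Prop) [Decidable P] (f : V → ℤ), ∑ x ∈ (univ.erase p).erase q,
      (if P then f x else 0) = if P then ∑ x ∈ (univ.erase p).erase q, f x else 0 := by
    intro P _ f
    split_ifs <;> simp
  rw [h4, h4, h2, h3]
  simp only [eq_comm (a := y) (b := 2), eq_comm (a := y) (b := 3)]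
  ring

theorem isomorphic [Fintype V] [DecidableEq V] [Fintype W] [DecidableEq W] {H : OrientedGraph W}
    {p' q' : W} (h : G.IsStandard p q) (h' : H.IsStandard p' q')
    (hcard : Fintype.card V = Fintype.card W) (hpq : G.sgn p q = H.sgn p' q')
    (hin : G.inArcs p q = H.inArcs p' q') : G.Isomorphic H := by
  obtain ⟨e, he⟩ := exists_equiv_of_card_fiber_eq
    (f := fun x => if x = p then 2 else if x = q then 3 else G.sgn q x)
    (g := fun x => if x = p' then 2 else if x = q' then 3 else H.sgn q' x) fun y => by
      have h1 := h.card_fiber y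
      have h2 := h'.card_fiber y
      rw [← hcard, ← hin] at h2
      exact_mod_cast h1.trans h2.symm
  have hq3 : ∀ x, x ≠ p' → x ≠ q' → H.sgn q' x ≠ 2 ∧ H.sgn q' x ≠ 3 := fun x h1 h2 => by
    rcases h'.sgn_right x h1 h2 with h0 | h0 <;> rw [h0] <;> norm_num
  have hep : e p = p' := by
    have h1 := he p
    simp only [if_true] at h1
    by_contra h2
    rw [if_neg h2] at h1
    split_ifs at h1 with h3
    · norm_num at h1
    · exact (hq3 _ h2 h3).1 h1
  have heq : e q = q' := by
    have h1 := he q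
    have h2 : e q ≠ p' := fun h2 => h.ne.symm (e.injective (h2.trans hep.symm))
    rw [if_neg h2, if_neg h.ne.symm, if_pos rfl] at h1
    by_contra h3
    rw [if_neg h3] at h1
    exact (hq3 _ h2 h3).2 h1
  have hne : ∀ x, (x ≠ p → e x ≠ p') ∧ (x ≠ q → e x ≠ q') := fun x =>
    ⟨fun h1 h2 => h1 (e.injective (h2.trans hep.symm)),
      fun h1 h2 => h1 (e.injective (h2.trans heq.symm))⟩
  have hright : ∀ x, x ≠ p → x ≠ q → H.sgn q' (e x) = G.sgn q x := by
    intro x h1 h2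
    have := he x
    rwa [if_neg ((hne x).1 h1), if_neg ((hne x).2 h2), if_neg h1, if_neg h2] at this
  have hp_row : ∀ y, G.sgn p y = H.sgn p' (e y) := by
    intro y
    by_cases h1 : y = p
    · rw [h1, hep, sgn_self, sgn_self]
    · by_cases h2 : y = q
      · rw [h2, heq, hpq]
      · rw [h.sgn_left y h1 h2, h'.sgn_left _ ((hne y).1 h1) ((hne y).2 h2)]
  have hq_row : ∀ y, G.sgn q y = H.sgn q' (e y) := by
    intro y
    by_cases h1 : y = p
    · rw [h1, hep, G.sgn_swap p q, H.sgn_swap p' q', hpq]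
    · by_cases h2 : y = q
      · rw [h2, heq, sgn_self, sgn_self]
      · rw [hright y h1 h2]
  have hall : ∀ x y, G.sgn x y = H.sgn (e x) (e y) := by
    intro x y
    by_cases hxp : x = p
    · rw [hxp, hep, hp_row]
    by_cases hxq : x = q
    · rw [hxq, heq, hq_row]
    by_cases hyp : y = p
    · rw [hyp, hep, G.sgn_swap p x, H.sgn_swap p' (e x), hp_row]
    by_cases hyq : y = q
    · rw [hyq, heq, G.sgn_swap q x, H.sgn_swap q' (e x), hq_row]
    rw [h.sgn_other x y hxp hxq hyp hyq, h'.sgn_other _ _ ((hne x).1 hxp) ((hne x).2 hxq)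
      ((hne y).1 hyp) ((hne y).2 hyq)]
  exact ⟨e, fun u v => by rw [adj_iff, adj_iff, hall]⟩

end IsStandard

end OrientedGraph

/-! ### Switching: invariants and reduction to standard form. -/

namespace OrientedGraph

section

variable {V W : Type*}

theorem sgn_switch (G : OrientedGraph V) (U : Set V) [DecidablePred (· ∈ U)] (u v : V) :
    (G.switch U).sgn u v =
      (if u ∈ U then -1 else 1) * (if v ∈ U then -1 else 1) * G.sgn u v := by
  have h := G.asymm u v
  by_cases hu : u ∈ U <;> by_cases hv : v ∈ U <;> simp only [sgn, switch, hu, hv] <;>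
    by_cases h1 : G.Adj u v <;> by_cases h2 : G.Adj v u <;> simp_all

theorem sgn_reverse (G : OrientedGraph V) (u v : V) : G.reverse.sgn u v = -G.sgn u v := by
  rw [← G.sgn_swap]
  rfl

theorem Isomorphic.exists_sgn_eq {G : OrientedGraph V} {H : OrientedGraph W}
    (h : G.Isomorphic H) : ∃ e : V ≃ W, ∀ u v, H.sgn (e u) (e v) = G.sgn u v := by
  obtain ⟨e, he⟩ := h
  refine ⟨e, fun u v => ?_⟩
  have h1 := he u v
  have h2 := he v u
  simp only [sgn]
  split_ifs <;> first | rfl | tauto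

theorem SwitchingIsomorphic.exists_sgn_eq {G : OrientedGraph V} {H : OrientedGraph W}
    (h : G.SwitchingIsomorphic H) : ∃ (e : V ≃ W) (θ : V → ℤ) (ε : ℤ), ε ^ 2 = 1 ∧
      (∀ u, θ u ^ 2 = 1) ∧ ∀ u v, H.sgn (e u) (e v) = ε * (θ u * θ v) * G.sgn u v := by
  classical
  have hθ : ∀ (U : Set V) (u : V), (if u ∈ U then (-1 : ℤ) else 1) ^ 2 = 1 := fun U u => by
    split_ifs <;> rfl
  obtain ⟨U, h | h⟩ := h
  · obtain ⟨e, he⟩ := h.exists_sgn_eq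
    refine ⟨e, fun u => if u ∈ U then -1 else 1, 1, rfl, hθ U, fun u v => ?_⟩
    rw [he, sgn_switch]
    ring
  · obtain ⟨e, he⟩ := h.exists_sgn_eq
    refine ⟨e, fun u => if u ∈ U then -1 else 1, -1, rfl, hθ U, fun u v => ?_⟩
    rw [he, sgn_reverse, sgn_switch]
    ring

theorem SwitchingIsomorphic.sgn_sq {G : OrientedGraph V} {H : OrientedGraph W} {e : V ≃ W}
    {θ : V → ℤ} {ε : ℤ} (hε : ε ^ 2 = 1) (hθ : ∀ u, θ u ^ 2 = 1)
    (h : ∀ u v, H.sgn (e u) (e v) = ε * (θ u * θ v) * G.sgn u v) (u v : V) :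
    H.sgn (e u) (e v) ^ 2 = G.sgn u v ^ 2 := by
  rw [h, mul_pow, mul_pow, mul_pow, hε, hθ, hθ]
  ring

theorem SwitchingIsomorphic.numArcs_eq [Fintype V] [Fintype W] {G : OrientedGraph V}
    {H : OrientedGraph W} (h : G.SwitchingIsomorphic H) : G.numArcs = H.numArcs := by
  obtain ⟨e, θ, ε, hε, hθ, he⟩ := h.exists_sgn_eq
  have h1 := G.degSum_eq
  have h2 := H.degSum_eq
  have h3 : degSum (fun u v => H.sgn u v ^ 2) univ = degSum (fun u v => G.sgn u v ^ 2) univ := by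
    simp only [degSum, degIn]
    rw [← e.sum_comp]
    refine sum_congr rfl fun u _ => ?_
    rw [← e.sum_comp]
    exact sum_congr rfl fun v _ => SwitchingIsomorphic.sgn_sq hε hθ he u v
  omega

theorem SwitchingIsomorphic.pfSum_eq [Fintype V] [Fintype W] {G : OrientedGraph V}
    {H : OrientedGraph W} (h : G.SwitchingIsomorphic H) : G.pfSum = H.pfSum := by
  obtain ⟨e, θ, ε, hε, hθ, he⟩ := h.exists_sgn_eq
  have key : ∀ a b c d, pfaffian₄ H.sgn (e a) (e b) (e c) (e d) ^ 2 =
      pfaffian₄ G.sgn a b c d ^ 2 := by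
    intro a b c d
    have h1 : pfaffian₄ H.sgn (e a) (e b) (e c) (e d) =
        ε ^ 2 * (θ a * θ b * θ c * θ d) * pfaffian₄ G.sgn a b c d := by
      simp only [pfaffian₄, he]
      ring
    rw [h1, hε]
    simp only [mul_pow, hθ]
    ring
  symm
  simp only [pfSum, quadSum, tripleSum]
  rw [← e.sum_comp]
  refine sum_congr rfl fun a _ => ?_
  rw [← e.sum_comp]
  refine sum_congr rfl fun b _ => ?_
  rw [← e.sum_comp]
  refine sum_congr rfl fun c _ => ?_
  rw [← e.sum_comp]
  exact sum_congr rfl fun d _ => key a b c d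

theorem SwitchingIsomorphic.connected {G : OrientedGraph V} {H : OrientedGraph W}
    (h : G.SwitchingIsomorphic H) (hH : H.Connected) : G.Connected := by
  obtain ⟨e, θ, ε, hε, hθ, he⟩ := h.exists_sgn_eq
  let i : G.underlying ≃g H.underlying :=
    { toEquiv := e
      map_rel_iff' := by
        intro u v
        rw [underlying_adj_iff, underlying_adj_iff, SwitchingIsomorphic.sgn_sq hε hθ he] }
  exact i.connected_iff.2 hH

/-- Equivalence preserves the zero pattern of the matrix, so `G` also has two vertices covering all
arcs and its energy attains the bound. -/
theorem SwitchingIsomorphic.skewEnergy_eq [Fintype V] [DecidableEq V] [Fintype W]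
    {G : OrientedGraph V} {H : OrientedGraph W} (h : G.SwitchingIsomorphic H) {p q : W}
    (hH : H.IsStandard p q) :
    G.skewEnergy = 2 * √(H.numArcs + 2 * √((H.pfSum : ℝ) / 24)) := by
  rw [← h.numArcs_eq, ← h.pfSum_eq]
  obtain ⟨e, θ, ε, hε, hθ, he⟩ := h.exists_sgn_eq
  refine G.skewEnergy_bound.2 (G.rank_skewAdjMatrix_le_four (p := e.symm p) (q := e.symm q) ?_)
  intro x y hxp hxq hyp hyq
  have h1 := SwitchingIsomorphic.sgn_sq hε hθ he x y
  rw [hH.sgn_other (e x) (e y) (fun h => hxp (by simp [← h])) (fun h => hxq (by simp [← h]))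
    (fun h => hyp (by simp [← h])) (fun h => hyq (by simp [← h]))] at h1
  exact pow_eq_zero_iff (two_ne_zero) |>.1 h1.symm

theorem exists_switch_sgn_eq (G : OrientedGraph V) (θ : V → ℤ) (hθ : ∀ u, θ u ^ 2 = 1) (η : ℤ)
    (hη : η ^ 2 = 1) : ∃ (U : Set V) (K : OrientedGraph V),
      (K = G.switch U ∨ K = (G.switch U).reverse) ∧
      ∀ u v, K.sgn u v = η * (θ u * θ v) * G.sgn u v := by
  classical
  have h1 : ∀ u, (if u ∈ {x | θ x = -1} then (-1 : ℤ) else 1) = θ u := by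
    intro u
    rcases sq_eq_one_iff.1 (hθ u) with h | h <;> simp [h]
  rcases sq_eq_one_iff.1 hη with h | h
  · refine ⟨{x | θ x = -1}, _, .inl rfl, fun u v => ?_⟩
    rw [sgn_switch, h1, h1, h, one_mul]
  · refine ⟨{x | θ x = -1}, _, .inr rfl, fun u v => ?_⟩
    rw [sgn_reverse, sgn_switch, h1, h1, h]
    ring

/-- The 4-cycles through `p` and `q` have vanishing Pfaffian, so `sgn p x * sgn q x` takes one value
ε on all common neighbours; a switching can then direct all arcs as prescribed. -/
theorem exists_switch_isStandard [Fintype V] [DecidableEq V] (G : OrientedGraph V)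
    (hQ : IsDoubleStar (fun u v => G.sgn u v ^ 2) univ)
    (hpf : ∀ a b c d, matchParity (fun u v => G.sgn u v ^ 2) a b c d =
      pfaffian₄ G.sgn a b c d ^ 2) :
    ∃ (U : Set V) (K : OrientedGraph V) (p q : V),
      (K = G.switch U ∨ K = (G.switch U).reverse) ∧ K.IsStandard p q := by
  obtain ⟨p, -, q, -, hpq, hdom, hcov⟩ := hQ
  have hother : ∀ x y, x ≠ p → x ≠ q → y ≠ p → y ≠ q → G.sgn x y = 0 := by
    intro x y hxp hxq hyp hyq
    refine (G.sgn_zero_or_sq x y).resolve_right fun h => ?_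
    rcases hcov x (mem_univ x) y (mem_univ y) hxp hyp h with h | h
    · exact hxq h
    · exact hyq h
  have hp : ∀ x, x ≠ p → x ≠ q → G.sgn p x ^ 2 = 1 := fun x h1 h2 => hdom x (mem_univ x) h1 h2
  have hconst : ∀ x y, x ≠ p → x ≠ q → y ≠ p → y ≠ q → G.sgn q x ^ 2 = 1 → G.sgn q y ^ 2 = 1 →
      G.sgn p x * G.sgn q x = G.sgn p y * G.sgn q y := by
    intro x y hxp hxq hyp hyq hx hy
    -- The quadruple has exactly two perfect matchings, so its parity is 0 and the Pfaffian
    -- vanishes.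
    have h1 := hpf p q x y
    have hx' := hp x hxp hxq
    have hy' := hp y hyp hyq
    simp only [matchParity, pfaffian₄, hother x y hxp hxq hyp hyq, hx, hy, hx', hy'] at h1
    norm_num at h1
    have h2 : G.sgn p x * G.sgn q y = G.sgn p y * G.sgn q x := by
      linarith [pow_eq_zero_iff two_ne_zero |>.1 h1.symm]
    linear_combination G.sgn q x * G.sgn q y * h2 - G.sgn p x * G.sgn q x * hy +
      G.sgn p y * G.sgn q y * hx
  obtain ⟨ε, hε, hεx⟩ : ∃ ε : ℤ, ε ^ 2 = 1 ∧ ∀ x, x ≠ p → x ≠ q → G.sgn q x ^ 2 = 1 →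
      G.sgn p x * G.sgn q x = ε := by
    by_cases h : ∃ x, x ≠ p ∧ x ≠ q ∧ G.sgn q x ^ 2 = 1
    · obtain ⟨x, hxp, hxq, hx⟩ := h
      refine ⟨G.sgn p x * G.sgn q x, by rw [mul_pow, hp x hxp hxq, hx]; rfl,
        fun y hyp hyq hy => hconst y x hyp hyq hxp hxq hy hx⟩
    · exact ⟨1, rfl, fun x hxp hxq hx => absurd ⟨x, hxp, hxq, hx⟩ h⟩
  obtain ⟨η, hη, hηpq⟩ : ∃ η : ℤ, η ^ 2 = 1 ∧
      (η * -ε * G.sgn p q = 0 ∨ η * -ε * G.sgn p q = 1) := by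
    rcases G.sgn_zero_or_sq p q with h | h
    · exact ⟨1, rfl, .inl (by rw [h, mul_zero])⟩
    · exact ⟨-ε * G.sgn p q, by rw [mul_pow, neg_sq, hε, h]; rfl,
        .inr (by linear_combination ε ^ 2 * h + hε)⟩
  -- The signs at the vertices `x` make all arcs leave `p`, and -ε at `q` makes the arcs between `q`
  -- and these vertices enter `q`. The global sign η turns an arc between the centres from `p` to
  -- `q`.
  obtain ⟨U, K, hK, hsgn⟩ := G.exists_switch_sgn_eq
    (fun x => if x = p then 1 else if x = q then -ε else η * G.sgn p x) (by
      intro x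
      split_ifs with h1 h2
      · rfl
      · rw [neg_sq, hε]
      · rw [mul_pow, hη, hp x h1 h2]
        rfl) η hη
  refine ⟨U, K, p, q, hK, hpq, ?_, fun x h1 h2 => ?_, fun x h1 h2 => ?_,
    fun x y h1 h2 h3 h4 => by rw [hsgn, hother x y h1 h2 h3 h4, mul_zero]⟩
  · rw [hsgn, if_pos rfl, if_neg hpq.symm, if_pos rfl, one_mul]
    exact hηpq
  · rw [hsgn, if_pos rfl, if_neg h1, if_neg h2]
    linear_combination η ^ 2 * hp x h1 h2 + hη
  · rw [hsgn, if_neg hpq.symm, if_pos rfl, if_neg h1, if_neg h2]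
    rcases G.sgn_zero_or_sq q x with h | h
    · left
      rw [h, mul_zero]
    · right
      linear_combination -ε * η ^ 2 * hεx x h1 h2 h - ε ^ 2 * hη - hε

end

end OrientedGraph

/-! ### The extremal graphs and the theorem. -/

namespace OrientedGraph

theorem sgn_of_adj {V : Type*} {G : OrientedGraph V} {u v : V} (h : G.Adj u v) : G.sgn u v = 1 :=
  (G.adj_iff u v).1 h

theorem sgn_of_adj_swap {V : Type*} {G : OrientedGraph V} {u v : V} (h : G.Adj v u) :
    G.sgn u v = -1 := by
  rw [G.sgn_swap, sgn_of_adj h]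

theorem sgn_of_not_adj {V : Type*} {G : OrientedGraph V} {u v : V} (h : ¬ G.Adj u v)
    (h' : ¬ G.Adj v u) : G.sgn u v = 0 := by
  simp [sgn, h, h']

theorem oPlus_adj {n m : ℕ} (i j : Fin n) : (oPlus n m).Adj i j ↔
    ((i : ℕ) = 0 ∧ (j : ℕ) ≠ 0) ∨ (2 ≤ (i : ℕ) ∧ (i : ℕ) + n ≤ m + 2 ∧ (j : ℕ) = 1) := Iff.rfl

theorem bPlus_adj {n m : ℕ} (i j : Fin n) : (bPlus n m).Adj i j ↔
    (((i : ℕ) = 0 ∧ (j : ℕ) ≠ 0) ∨ (2 ≤ (i : ℕ) ∧ (i : ℕ) + n ≤ m + 3 ∧ (j : ℕ) = 1)) ∧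
      ¬ ((i : ℕ) = 0 ∧ (j : ℕ) = 1) := Iff.rfl

/-- An oriented graph on `Fin n` with the arcs of a standard one is determined by the sets of
in-neighbours of `1`. -/
theorem isStandard_of_adj {n c : ℕ} (hn : 1 < n) (hc2 : 2 ≤ c) (hc : c < n)
    {G : OrientedGraph (Fin n)}
    (hleft : ∀ x : Fin n, 2 ≤ (x : ℕ) → G.Adj ⟨0, by omega⟩ x)
    (hcenters : ¬ G.Adj ⟨1, hn⟩ ⟨0, by omega⟩)
    (hright : ∀ x : Fin n, 2 ≤ (x : ℕ) → ¬ G.Adj ⟨1, hn⟩ x ∧ (G.Adj x ⟨1, hn⟩ ↔ (x : ℕ) ≤ c))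
    (hother : ∀ x y : Fin n, 2 ≤ (x : ℕ) → 2 ≤ (y : ℕ) → ¬ G.Adj x y) :
    G.IsStandard ⟨0, by omega⟩ ⟨1, hn⟩ ∧ G.inArcs ⟨0, by omega⟩ ⟨1, hn⟩ = c - 1 := by
  have h2 : ∀ x : Fin n, x ≠ ⟨0, by omega⟩ → x ≠ ⟨1, hn⟩ → 2 ≤ (x : ℕ) := by
    intro x h0 h1
    rw [Ne, Fin.ext_iff] at h0 h1
    simp only at h0 h1
    omega
  refine ⟨⟨by simp, ?_, fun x h h' => sgn_of_adj (hleft x (h2 x h h')), fun x h h' => ?_,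
    fun x y h h' k k' => ?_⟩, ?_⟩
  · by_cases h : G.Adj ⟨0, by omega⟩ ⟨1, hn⟩
    · exact .inr (sgn_of_adj h)
    · exact .inl (sgn_of_not_adj h hcenters)
  · have h3 := hright x (h2 x h h')
    by_cases hx : (x : ℕ) ≤ c
    · exact .inr (sgn_of_adj_swap (h3.2.2 hx))
    · exact .inl (sgn_of_not_adj h3.1 fun h => hx (h3.2.1 h))
  · exact sgn_of_not_adj (hother x y (h2 x h h') (h2 y k k')) (hother y x (h2 y k k') (h2 x h h'))
  · have : ((univ.erase (⟨0, by omega⟩ : Fin n)).erase ⟨1, hn⟩).filter (G.sgn ⟨1, hn⟩ · = -1) =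
        Icc ⟨2, by omega⟩ ⟨c, hc⟩ := by
      ext x
      simp only [mem_filter, mem_erase, mem_univ, and_true, mem_Icc, Fin.le_def]
      constructor
      · rintro ⟨⟨h1, h0⟩, hs⟩
        refine ⟨h2 x h0 h1, (hright x (h2 x h0 h1)).2.1 ((G.adj_iff _ _).2 ?_)⟩
        rw [G.sgn_swap, hs]
        rfl
      · rintro ⟨hx2, hxc⟩
        refine ⟨⟨?_, ?_⟩, sgn_of_adj_swap ((hright x hx2).2.2 hxc)⟩ <;> rw [Ne, Fin.ext_iff] <;>
          simp only <;> omega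
    rw [inArcs, this, Fin.card_Icc]
    simp only
    omega

theorem isStandard_oPlus {n m : ℕ} (hn : 1 < n) (hnm : n ≤ m) (hm : m + 4 < 2 * n) :
    (oPlus n m).IsStandard ⟨0, by omega⟩ ⟨1, hn⟩ ∧
      (oPlus n m).inArcs ⟨0, by omega⟩ ⟨1, hn⟩ = m + 1 - n ∧
      (oPlus n m).sgn ⟨0, by omega⟩ ⟨1, hn⟩ = 1 := by
  have h := isStandard_of_adj (G := oPlus n m) hn (c := m + 2 - n) (by omega) (by omega)
    (fun x hx => .inl ⟨rfl, by omega⟩) (by rw [oPlus_adj]; simp only; omega)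
    (fun x hx => by simp only [oPlus_adj]; norm_num; omega) (fun x y hx hy => by rw [oPlus_adj]; omega)
  exact ⟨h.1, h.2.trans (by omega), sgn_of_adj (by rw [oPlus_adj]; simp)⟩

theorem isStandard_bPlus {n m : ℕ} (hn : 1 < n) (hnm : n ≤ m) (hm : m + 4 < 2 * n) :
    (bPlus n m).IsStandard ⟨0, by omega⟩ ⟨1, hn⟩ ∧
      (bPlus n m).inArcs ⟨0, by omega⟩ ⟨1, hn⟩ = m + 2 - n ∧
      (bPlus n m).sgn ⟨0, by omega⟩ ⟨1, hn⟩ = 0 := by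
  have h := isStandard_of_adj (G := bPlus n m) hn (c := m + 3 - n) (by omega) (by omega)
    (fun x hx => ⟨.inl ⟨rfl, by omega⟩, fun h => by omega⟩) (by rw [bPlus_adj]; simp only; omega)
    (fun x hx => by simp only [bPlus_adj]; norm_num; omega) (fun x y hx hy => by rw [bPlus_adj]; omega)
  refine ⟨h.1, h.2.trans (by omega), sgn_of_not_adj ?_ ?_⟩ <;> rw [bPlus_adj] <;> simp

theorem numArcs_switch_or_reverse {V : Type*} [Fintype V] {G K : OrientedGraph V} {U : Set V}
    (hK : K = G.switch U ∨ K = (G.switch U).reverse) : G.numArcs = K.numArcs := by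
  have hrefl : K.Isomorphic K := ⟨Equiv.refl V, fun _ _ => Iff.rfl⟩
  refine SwitchingIsomorphic.numArcs_eq ⟨U, ?_⟩
  rcases hK with rfl | rfl
  · exact .inl hrefl
  · exact .inr hrefl

/-- A double star with all quadruples even is equivalent to `oPlus` or to `bPlus`. -/
theorem switchingIsomorphic_of_isDoubleStar {n m : ℕ} (hnm : n ≤ m) (hm : m + 4 < 2 * n)
    {G : OrientedGraph (Fin n)} (hG : G.numArcs = m)
    (hQ : IsDoubleStar (fun u v => G.sgn u v ^ 2) univ)
    (hpf : ∀ a b c d, matchParity (fun u v => G.sgn u v ^ 2) a b c d =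
      pfaffian₄ G.sgn a b c d ^ 2) :
    G.SwitchingIsomorphic (oPlus n m) ∨ G.SwitchingIsomorphic (bPlus n m) := by
  obtain ⟨U, K, p, q, hK, hstd⟩ := G.exists_switch_isStandard hQ hpf
  have hKm := (numArcs_switch_or_reverse hK).symm.trans hG
  have hcount := hstd.numArcs_eq
  rw [hKm, Fintype.card_fin] at hcount
  obtain ⟨hO, hO', hO''⟩ := isStandard_oPlus (n := n) (m := m) (by omega) hnm hm
  obtain ⟨hB, hB', hB''⟩ := isStandard_bPlus (n := n) (m := m) (by omega) hnm hm
  have hiso : ∀ H : OrientedGraph (Fin n), K.Isomorphic H → G.SwitchingIsomorphic H := by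
    rintro H h
    refine ⟨U, ?_⟩
    rcases hK with rfl | rfl
    · exact .inl h
    · exact .inr h
  rcases hstd.sgn_centers with h | h
  · exact .inr (hiso _ (hstd.isomorphic hB rfl (by rw [h, hB'']) (by rw [hB']; omega)))
  · exact .inl (hiso _ (hstd.isomorphic hO rfl (by rw [h, hO'']) (by rw [hO']; omega)))

/-- The bound on odd quadruples with k = m - n + 1; its two alternatives are the values of `pfSum`
at the two extremal graphs. -/
theorem le_pfSum {n m : ℕ} (hnm : n ≤ m) (hm : m + 4 < 2 * n) {G : OrientedGraph (Fin n)}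
    (hG : G.Connected) (hGm : G.numArcs = m) :
    ((oPlus n m).pfSum ≤ G.pfSum ∨ (bPlus n m).pfSum ≤ G.pfSum) ∧
      (G.pfSum ≤ (oPlus n m).pfSum → G.pfSum ≤ (bPlus n m).pfSum →
        G.SwitchingIsomorphic (oPlus n m) ∨ G.SwitchingIsomorphic (bPlus n m)) := by
  obtain ⟨hO, hO', -⟩ := isStandard_oPlus (n := n) (m := m) (by omega) hnm hm
  obtain ⟨hB, hB', -⟩ := isStandard_bPlus (n := n) (m := m) (by omega) hnm hm
  have hdeg := G.degSum_eq
  rw [hGm] at hdeg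
  have hbound := G.isAdjFun.quadBound univ n (m - n + 1) (by simp) (by rw [hdeg]; ring)
    (G.hasNoSmallComponent hG (by rw [Fintype.card_fin]; omega))
  have hle : quadSum univ (matchParity fun u v => G.sgn u v ^ 2) ≤ G.pfSum :=
    quadSum_matchParity_le G.sgn
  have hOpf : (oPlus n m).pfSum = 24 * (((m : ℤ) - n + 1) * (n - 2 - (m - n + 1))) := by
    rw [hO.pfSum_eq, hO', Fintype.card_fin, Nat.cast_sub (by omega)]
    push_cast
    ring
  have hBpf : (bPlus n m).pfSum =
      24 * (((m : ℤ) - n + 1 + 1) * (n - 3 - (m - n + 1))) := by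
    rw [hB.pfSum_eq, hB', Fintype.card_fin, Nat.cast_sub (by omega)]
    push_cast
    ring
  rw [QuadBound, ← hOpf, ← hBpf] at hbound
  refine ⟨hbound.1.imp (fun h => h.trans hle) fun h => h.trans hle, fun h1 h2 => ?_⟩
  refine switchingIsomorphic_of_isDoubleStar hnm hm hGm
    (hbound.2 (by omega) (by omega) (hle.trans h1) (hle.trans h2))
    (matchParity_eq_pfaffian₄_sq_of_quadSum_le ?_)
  -- Whichever alternative holds, `pfSum` is squeezed down to the parity count, so the two agree on
  -- every quadruple.
  rcases hbound.1 with h | h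
  · exact h1.trans h
  · exact h2.trans h

theorem pfSum_oPlus_sub_bPlus {n m : ℕ} (hnm : n ≤ m) (hm : m + 4 < 2 * n) :
    (oPlus n m).pfSum - (bPlus n m).pfSum = 24 * (2 * m - (3 * n - 5)) := by
  obtain ⟨hO, hO', -⟩ := isStandard_oPlus (n := n) (m := m) (by omega) hnm hm
  obtain ⟨hB, hB', -⟩ := isStandard_bPlus (n := n) (m := m) (by omega) hnm hm
  rw [hO.pfSum_eq, hO', hB.pfSum_eq, hB', Fintype.card_fin, Nat.cast_sub (by omega),
    Nat.cast_sub (by omega)]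
  push_cast
  ring

theorem two_mul_sqrt_le_iff {m : ℝ} (hm : 0 ≤ m) {b c : ℤ} (hc : 0 ≤ c) :
    2 * √(m + 2 * √((b : ℝ) / 24)) ≤ 2 * √(m + 2 * √((c : ℝ) / 24)) ↔ b ≤ c := by
  have hc' : (0 : ℝ) ≤ c := by exact_mod_cast hc
  rw [mul_le_mul_iff_of_pos_left two_pos, Real.sqrt_le_sqrt_iff (by positivity),
    add_le_add_iff_left, mul_le_mul_iff_of_pos_left two_pos, Real.sqrt_le_sqrt_iff (by positivity),
    div_le_div_iff_of_pos_right (by norm_num), Int.cast_le]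

/-- Both candidates attain the energy bound, which is increasing in `pfSum`. So comparing energies
amounts to comparing `pfSum`, and the minimum is the smaller of the two candidate values. -/
theorem isMinimalSkewEnergy_iff {n m : ℕ} (hnm : n ≤ m) (hm : m + 4 < 2 * n)
    (G : OrientedGraph (Fin n)) :
    G.IsMinimalSkewEnergy m ↔
      (G.SwitchingIsomorphic (oPlus n m) ∧ (oPlus n m).pfSum ≤ (bPlus n m).pfSum) ∨
      (G.SwitchingIsomorphic (bPlus n m) ∧ (bPlus n m).pfSum ≤ (oPlus n m).pfSum) := by
  obtain ⟨hO, hO', hO''⟩ := isStandard_oPlus (n := n) (m := m) (by omega) hnm hm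
  obtain ⟨hB, hB', hB''⟩ := isStandard_bPlus (n := n) (m := m) (by omega) hnm hm
  have hOm : (oPlus n m).numArcs = m := by
    have := hO.numArcs_eq
    rw [hO', hO'', Fintype.card_fin] at this
    omega
  have hBm : (bPlus n m).numArcs = m := by
    have := hB.numArcs_eq
    rw [hB', hB'', Fintype.card_fin] at this
    omega
  have hOc := hO.connected (by rw [hO', hO'']; omega)
  have hBc := hB.connected (by rw [hB', hB'']; omega)
  have hself : ∀ H : OrientedGraph (Fin n), H.SwitchingIsomorphic H := fun H =>
    ⟨∅, .inl ⟨Equiv.refl _, fun u v => by simp [switch]⟩⟩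
  have hm0 : (0 : ℝ) ≤ m := Nat.cast_nonneg m
  constructor
  · rintro ⟨hc, hGm, hmin⟩
    have h1 := G.skewEnergy_bound.1
    rw [hGm] at h1
    have h2 := h1.trans (hmin _ hOc hOm)
    have h3 := h1.trans (hmin _ hBc hBm)
    rw [(hself _).skewEnergy_eq hO, hOm, two_mul_sqrt_le_iff hm0 (pfSum_nonneg _)] at h2
    rw [(hself _).skewEnergy_eq hB, hBm, two_mul_sqrt_le_iff hm0 (pfSum_nonneg _)] at h3
    rcases (le_pfSum hnm hm hc hGm).2 h2 h3 with h | h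
    · exact .inl ⟨h, h.pfSum_eq ▸ h3⟩
    · exact .inr ⟨h, h.pfSum_eq ▸ h2⟩
  · have key : ∀ (K : OrientedGraph (Fin n)) (p q : Fin n), K.IsStandard p q → K.Connected →
        K.numArcs = m → K.pfSum ≤ (oPlus n m).pfSum → K.pfSum ≤ (bPlus n m).pfSum →
        G.SwitchingIsomorphic K → G.IsMinimalSkewEnergy m := by
      intro K p q hK hKc hKm h1 h2 h
      refine ⟨h.connected hKc, h.numArcs_eq.trans hKm, fun H hH hHm => ?_⟩
      have h3 := H.skewEnergy_bound.1
      rw [hHm] at h3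
      rw [h.skewEnergy_eq hK, hKm]
      refine le_trans ((two_mul_sqrt_le_iff hm0 H.pfSum_nonneg).2 ?_) h3
      rcases (le_pfSum hnm hm hH hHm).1 with h4 | h4
      · exact h1.trans h4
      · exact h2.trans h4
    rintro (⟨h, hle⟩ | ⟨h, hle⟩)
    · exact key _ _ _ hO hOc hOm le_rfl hle h
    · exact key _ _ _ hB hBc hBm hle le_rfl h

end OrientedGraph

theorem mainTheorem1 (n m : ℕ) (hnm : n ≤ m) (hm : (m : ℚ) < 2 * ((n : ℚ) - 2))
    (G : OrientedGraph (Fin n)) :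
    ((m : ℚ) < (3 * (n : ℚ) - 5) / 2 →
      (G.IsMinimalSkewEnergy m ↔ G.SwitchingIsomorphic (OrientedGraph.oPlus n m))) ∧
    ((m : ℚ) = (3 * (n : ℚ) - 5) / 2 →
      (G.IsMinimalSkewEnergy m ↔
        G.SwitchingIsomorphic (OrientedGraph.oPlus n m) ∨
        G.SwitchingIsomorphic (OrientedGraph.bPlus n m))) ∧
    ((3 * (n : ℚ) - 5) / 2 < (m : ℚ) →
      (G.IsMinimalSkewEnergy m ↔ G.SwitchingIsomorphic (OrientedGraph.bPlus n m))) := by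
  have hm' : m + 4 < 2 * n := by
    have : (m : ℚ) + 4 < 2 * n := by linarith
    exact_mod_cast this
  have hsub := OrientedGraph.pfSum_oPlus_sub_bPlus hnm hm'
  have hiff := OrientedGraph.isMinimalSkewEnergy_iff hnm hm' G
  refine ⟨fun h => ?_, fun h => ?_, fun h => ?_⟩
  · have h1 : 2 * (m : ℤ) < 3 * n - 5 := by
      have : 2 * (m : ℚ) < 3 * n - 5 := by linarith
      exact_mod_cast this
    rw [hiff, and_iff_left (by linarith), or_iff_left fun h2 => by linarith [h2.2]]
  · have h1 : 2 * (m : ℤ) = 3 * n - 5 := by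
      have : 2 * (m : ℚ) = 3 * n - 5 := by linarith
      exact_mod_cast this
    rw [hiff, and_iff_left (by linarith), and_iff_left (by linarith)]
  · have h1 : 3 * (n : ℤ) - 5 < 2 * m := by
      have : 3 * (n : ℚ) - 5 < 2 * m := by linarith
      exact_mod_cast this
    rw [hiff, and_iff_left (b := _ ≤ (OrientedGraph.oPlus n m).pfSum) (by linarith),
      or_iff_right fun h2 => by linarith [h2.2]]
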